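/- Let $\lambda(1,0),\lambda(0,1),\lambda(-1,0),\lambda(0,-1),\lambda(-1,-1)$ be positive constants and put $c_1=\lambda(-1,0)$, $c_2=\lambda(0,-1)$, $c_3=\lambda(-1,-1)$. Let $\xi=(\xi(t))_{t\ge 0}$ be the continuous-time Markov jump process on $\mathbb Z_+^2$ with $\xi(0)=(0,0)$ which, in the state $z=(z_1,z_2)$, makes the jumps $(1,0)$, $(0,1)$, $(-1,0)$, $(0,-1)$, $(-1,-1)$ with intensities $\lambda(1,0)$, $\lambda(0,1)$, $c_1z_1$, $c_2z_2$, $c_3\min\{z_1,z_2\}$ respectively: it stays in $z$ for an exponential time whose parameter $h(z)$ is the sum of these five intensities, and then makes one of the five jumps with probability equal to its intensity divided by $h(z)$. For $T>0$ let $\xi_T(t)=\xi(tT)/T$, $t\in[0,1]$. Let $X$ be the set of right-continuous functions $x:[0,1]\to\mathbb R_+^2$ with left limits, with finitely many jumps and with $x(0)=(0,0)$, and let $F\subset X$ be the set of continuous $f=(f_1,f_2)\in X$ with $f_1(t)>0$ and $f_2(t)>0$ for all $t\in(0,1]$. For $f\in F$ and $\varepsilon>0$ let $U_\varepsilon(f)=\{g\in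 X:\ \sup_{t\in[0,1]}\|f(t)-g(t)\|<\varepsilon\}$, where $\|\cdot\|$ is the Euclidean norm, and let $$I(f)=\int_0^1\bigl(c_1f_1(t)+c_2f_2(t)+c_3\min\{f_1(t),f_2(t)\}\bigr)\,dt .$$ Then for every $f\in F$ and every $\varepsilon>0$ the probability $\mathbf P(\xi_T\in U_\varepsilon(f))$ is positive for all large $T$, the limit $\lim_{T\to\infty}T^{-2}\ln\mathbf P(\xi_T\in U_\varepsilon(f))$ exists and is finite, and $$\lim_{\varepsilon\to0}\ \lim_{T\to\infty}\frac1{T^2}\ln\mathbf P\bigl(\xi_T\in U_\varepsilon(f)\bigr)=-I(f).$$ -/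

import Mathlib

open Filter Topology MeasureTheory

noncomputable section

/-- The set of possible jumps of the process. -/
def jumpSet : Finset (ℤ × ℤ) := {(1, 0), (0, 1), (-1, 0), (0, -1), (-1, -1)}

/-- Intensity of the jump `y` in the state `z` of the quadrant lattice `ℕ × ℕ`, for given
constants `lam y`. It is zero for `y` outside `jumpSet`, and zero for every jump that would
leave the quadrant. -/
def jumpRate (lam : ℤ × ℤ → ℝ) (z : ℕ × ℕ) (y : ℤ × ℤ) : ℝ :=
  if y = (1, 0) then lam (1, 0)
  else if y = (0, 1) then lam (0, 1)
  else if y = (-1, 0) then (z.1 : ℝ) * lam (-1, 0)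
  else if y = (0, -1) then (z.2 : ℝ) * lam (0, -1)
  else if y = (-1, -1) then (min z.1 z.2 : ℝ) * lam (-1, -1)
  else 0

/-- The total intensity `h(z)` of leaving the state `z`. -/
def totalRate (lam : ℤ × ℤ → ℝ) (z : ℕ × ℕ) : ℝ := ∑ y ∈ jumpSet, jumpRate lam z y

/-- The probability that a jump from `z` is the jump `y`. -/
def jumpProb (lam : ℤ × ℤ → ℝ) (z : ℕ × ℕ) (y : ℤ × ℤ) : ℝ :=
  jumpRate lam z y / totalRate lam z

/-- The increment from `z` to `w`. -/
def increment (z w : ℕ × ℕ) : ℤ × ℤ := ((w.1 : ℤ) - (z.1 : ℤ), (w.2 : ℤ) - (z.2 : ℤ))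

/-- `Y n` (the successive states) and `τ n` (the time spent in the state `Y n`) are the embedded
chain and the holding times of the Markov jump process started from `(0, 0)`: given the past, the
state `z = Y n` is kept for an exponential time with parameter `totalRate lam z`, and,
independently of that time, the next jump is `y` with probability `jumpProb lam z y`.
This is expressed by the joint law of `Y 0, τ 0, Y 1, …, τ (n - 1), Y n` for all `n`. -/
structure IsJumpChain (lam : ℤ × ℤ → ℝ) {Ω : Type*} [MeasurableSpace Ω] (P : Measure Ω)
    (Y : ℕ → Ω → ℕ × ℕ) (τ : ℕ → Ω → ℝ) : Prop where
  measurable_state : ∀ n, Measurable (Y n)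
  measurable_holding : ∀ n, Measurable (τ n)
  law : ∀ (n : ℕ) (z : ℕ → ℕ × ℕ) (s : ℕ → ℝ), z 0 = (0, 0) → (∀ i, 0 ≤ s i) →
    P {ω | Y 0 ω = z 0 ∧ ∀ i < n, s i < τ i ω ∧ Y (i + 1) ω = z (i + 1)} =
      ENNReal.ofReal (∏ i ∈ Finset.range n,
        Real.exp (-(totalRate lam (z i) * s i)) * jumpProb lam (z i) (increment (z i) (z (i + 1))))

/-- `ξ` is (a version of) the Markov jump process on `ℕ × ℕ` with jump intensities `jumpRate lam`,
started from `(0, 0)`: almost surely, `ξ` equals `Y n` between the `n`-th jump time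
`τ 0 + ⋯ + τ (n - 1)` (included) and the next one (excluded). Only times `t ≥ 0` matter. -/
def IsJumpProcess (lam : ℤ × ℤ → ℝ) {Ω : Type*} [MeasurableSpace Ω] (P : Measure Ω)
    (ξ : ℝ → Ω → ℕ × ℕ) : Prop :=
  ∃ (Y : ℕ → Ω → ℕ × ℕ) (τ : ℕ → Ω → ℝ), IsJumpChain lam P Y τ ∧
    ∀ᵐ ω ∂P, ∀ (n : ℕ) (t : ℝ), ∑ i ∈ Finset.range n, τ i ω ≤ t →
      t < ∑ i ∈ Finset.range (n + 1), τ i ω → ξ t ω = Y n ω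

/-- The rescaled path `t ↦ ξ(tT)/T`, `t ∈ [0, 1]`. -/
def scaledPath {Ω : Type*} (ξ : ℝ → Ω → ℕ × ℕ) (T : ℝ) (ω : Ω) :
    unitInterval → EuclideanSpace ℝ (Fin 2) :=
  fun t => !₂[((ξ ((t : ℝ) * T) ω).1 : ℝ) / T, ((ξ ((t : ℝ) * T) ω).2 : ℝ) / T]

/-- The space `X` of paths `[0, 1] → ℝ²` with non-negative coordinates, starting from `0`, that
are right-continuous with left limits and have finitely many jumps. -/
def pathSpace : Set (unitInterval → EuclideanSpace ℝ (Fin 2)) :=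
  {x | x 0 = 0 ∧ (∀ t i, 0 ≤ x t i) ∧
    (∀ t, ContinuousWithinAt x (Set.Ici t) t) ∧
    (∀ t, ∃ l, Tendsto x (𝓝[<] t) (𝓝 l)) ∧
    {t | ¬ ContinuousAt x t}.Finite}

/-- The set `F` of continuous paths in `X` both coordinates of which are positive for `t > 0`. -/
def excursionSet : Set (unitInterval → EuclideanSpace ℝ (Fin 2)) :=
  {f ∈ pathSpace | Continuous f ∧ ∀ t, 0 < t → 0 < f t 0 ∧ 0 < f t 1}

/-- The uniform distance between two paths (for the Euclidean norm on the plane). -/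
def uniformDist (x y : unitInterval → EuclideanSpace ℝ (Fin 2)) : ENNReal :=
  ⨆ t, edist (x t) (y t)

/-- The open `ε`-neighbourhood of `f` in `X` for the uniform distance. -/
def uniformNhd (f : unitInterval → EuclideanSpace ℝ (Fin 2)) (ε : ℝ) :
    Set (unitInterval → EuclideanSpace ℝ (Fin 2)) :=
  {g ∈ pathSpace | uniformDist f g < ENNReal.ofReal ε}

/-- The rate function on `F`. -/
def rateFunction (lam : ℤ × ℤ → ℝ) (f : unitInterval → EuclideanSpace ℝ (Fin 2)) : ℝ :=
  ∫ t : unitInterval,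
    (lam (-1, 0) * f t 0 + lam (0, -1) * f t 1 + lam (-1, -1) * min (f t 0) (f t 1))

end

/-! A trajectory with states `z i` and holding times `s i` has density `∏ jumpRate · exp (-totalRate
· s i)`. The exponent contains the integral of `stateCost` along the trajectory, which after
rescaling is `T ^ 2 * rateFunction`. Everything else is of smaller order than `T ^ 2` in the
exponent. So the inner limit is minus the infimum `infRate` of the rate function over the
neighbourhood; since the integrand is Lipschitz, this infimum tends to the rate at `f`
(`tendsto_infRate`).

Upper bound (`measure_le_of_box`, `measure_uniformNhd_le`). An exponential Chebyshev inequality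
replaces each holding rate by a free parameter `θ`, at the price `exp (θ * T)` and a factor
`jumpRate / θ` per jump. It remains to sum these products over all lattice paths. Births have
intensity of order 1, deaths of order `T`, but a path from the origin in the quadrant cannot remove
more mass than it has created. Weighting each jump by `√T` to the power of the change of the
coordinate sum therefore only increases the products and makes every one-step sum of order `√T`.
With `θ` a large multiple of `√T` the sum over the number of jumps is geometric, and the price is
`exp (O(T ^ (3/2)))`. The same estimate excludes infinitely many jumps before `T` while the path
stays in the neighbourhood.

Lower bound (`eventually_le_measure_uniformNhd`). A nearly optimal path is smoothed to a Lipschitz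
curve `g` still inside the neighbourhood (`exists_lipschitz_of_mem_uniformNhd`). A fixed lattice
path follows `T • g` with `O(T)` jumps at nearly regular times (`trackingPath`). Each jump costs a
factor of order `1 / T` besides the exponential of the intensity, in total `exp (-O(T log T))`. -/

noncomputable section

/-! ### Intensities and jump probabilities -/

/-- The part of the total intensity that depends on the state. -/
def stateCost (lam : ℤ × ℤ → ℝ) (z : ℕ × ℕ) : ℝ :=
  lam (-1, 0) * z.1 + lam (0, -1) * z.2 + lam (-1, -1) * min (z.1 : ℝ) z.2

lemma sum_jumpSet {M : Type*} [AddCommMonoid M] (F : ℤ × ℤ → M) :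
    ∑ y ∈ jumpSet, F y = F (1, 0) + (F (0, 1) + (F (-1, 0) + (F (0, -1) + F (-1, -1)))) := by
  rw [jumpSet, Finset.sum_insert (by decide), Finset.sum_insert (by decide),
    Finset.sum_insert (by decide), Finset.sum_insert (by decide), Finset.sum_singleton]

lemma totalRate_eq (lam : ℤ × ℤ → ℝ) (z : ℕ × ℕ) :
    totalRate lam z = lam (1, 0) + lam (0, 1) + stateCost lam z := by
  rw [totalRate, sum_jumpSet, stateCost]
  simp [jumpRate]
  ring

lemma jumpRate_eq_zero_of_notMem (lam : ℤ × ℤ → ℝ) (z : ℕ × ℕ) {y : ℤ × ℤ} (hy : y ∉ jumpSet) :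
    jumpRate lam z y = 0 := by
  simp only [jumpSet, Finset.mem_insert, Finset.mem_singleton, not_or] at hy
  simp [jumpRate, hy]

section Positive

variable {lam : ℤ × ℤ → ℝ} (hlam : ∀ y ∈ jumpSet, 0 < lam y)
include hlam

lemma jumpRate_nonneg (z : ℕ × ℕ) (y : ℤ × ℤ) : 0 ≤ jumpRate lam z y := by
  have h1 := (hlam (1, 0) (by decide)).le
  have h2 := (hlam (0, 1) (by decide)).le
  have h3 := (hlam (-1, 0) (by decide)).le
  have h4 := (hlam (0, -1) (by decide)).le
  have h5 := (hlam (-1, -1) (by decide)).le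
  unfold jumpRate
  split_ifs <;> positivity

lemma stateCost_nonneg (z : ℕ × ℕ) : 0 ≤ stateCost lam z := by
  have h3 := (hlam (-1, 0) (by decide)).le
  have h4 := (hlam (0, -1) (by decide)).le
  have h5 := (hlam (-1, -1) (by decide)).le
  unfold stateCost
  positivity

lemma totalRate_pos (z : ℕ × ℕ) : 0 < totalRate lam z := by
  rw [totalRate_eq]
  have h1 := hlam (1, 0) (by decide)
  have h2 := hlam (0, 1) (by decide)
  have h3 := stateCost_nonneg hlam z
  positivity

lemma jumpProb_nonneg (z : ℕ × ℕ) (y : ℤ × ℤ) : 0 ≤ jumpProb lam z y :=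
  div_nonneg (jumpRate_nonneg hlam z y) (totalRate_pos hlam z).le

omit hlam in
lemma increment_injective (z : ℕ × ℕ) : Function.Injective (increment z) := by
  rintro ⟨a, b⟩ ⟨c, d⟩ h
  simp only [increment, Prod.mk.injEq] at h
  ext <;> simp <;> omega

-- Death intensities vanish on the axes, so a jump of nonzero intensity never leaves the quadrant.
omit hlam in
lemma mem_range_increment {z : ℕ × ℕ} {y : ℤ × ℤ} (h : jumpRate lam z y ≠ 0) :
    y ∈ Set.range (increment z) := by
  have hy : 0 ≤ (z.1 : ℤ) + y.1 ∧ 0 ≤ (z.2 : ℤ) + y.2 := by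
    rcases Decidable.em (y ∈ jumpSet) with hy | hy
    · simp only [jumpSet, Finset.mem_insert, Finset.mem_singleton] at hy
      rcases hy with rfl | rfl | rfl | rfl | rfl
      · simp; omega
      · simp; omega
      · have : z.1 ≠ 0 := fun h0 => h (by simp [jumpRate, h0])
        simp; omega
      · have : z.2 ≠ 0 := fun h0 => h (by simp [jumpRate, h0])
        simp; omega
      · have h1 : z.1 ≠ 0 := fun h0 => h (by simp [jumpRate, h0])
        have h2 : z.2 ≠ 0 := fun h0 => h (by simp [jumpRate, h0])
        simp; omega
    · exact absurd (jumpRate_eq_zero_of_notMem lam z hy) h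
  refine ⟨(((z.1 : ℤ) + y.1).toNat, ((z.2 : ℤ) + y.2).toNat), ?_⟩
  ext <;> simp [increment] <;> omega

-- Different successors have different increments, and every jump of nonzero intensity leads to a
-- successor; hence sums over the next state reduce to five terms.
omit hlam in
lemma tsum_increment (z : ℕ × ℕ) (F : ℤ × ℤ → ENNReal)
    (hF : ∀ y, jumpRate lam z y = 0 → F y = 0) :
    ∑' w, F (increment z w) = ∑ y ∈ jumpSet, F y := by
  rw [(increment_injective z).tsum_eq (f := F)]
  · exact tsum_eq_sum fun y hy => hF y (jumpRate_eq_zero_of_notMem lam z hy)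
  · exact fun y hy => mem_range_increment (lam := lam) fun h => hy (hF y h)

lemma tsum_jumpProb (z : ℕ × ℕ) :
    ∑' w, ENNReal.ofReal (jumpProb lam z (increment z w)) = 1 := by
  rw [tsum_increment (lam := lam) z fun y => ENNReal.ofReal (jumpProb lam z y)]
  · rw [← ENNReal.ofReal_sum_of_nonneg fun y _ => jumpProb_nonneg hlam z y]
    unfold jumpProb
    rw [← Finset.sum_div, ← totalRate, div_self (totalRate_pos hlam z).ne', ENNReal.ofReal_one]
  · intro y hy
    simp [jumpProb, hy]

end Positive

/-! ### Sums over finite paths -/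

section PathSums

variable {S : Type*}

/-- The sequence whose first terms are the entries of a tuple. -/
def tupleSeq {n : ℕ} (z : Fin (n + 1) → S) (k : ℕ) : S := z (Fin.ofNat (n + 1) k)

/-- Beyond `n` the index wraps around modulo `n + 1`, so only `k ≤ n` is meaningful. Tuples are used
because finite paths on the lattice are countable. -/
lemma tupleSeq_of_le {n : ℕ} (z : Fin (n + 1) → S) {k : ℕ} (hk : k ≤ n) :
    tupleSeq z k = z ⟨k, Nat.lt_succ_of_le hk⟩ := by
  unfold tupleSeq
  congr 1
  ext
  simp [Fin.ofNat, Nat.mod_eq_of_lt (Nat.lt_succ_of_le hk)]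

lemma tupleSeq_snoc_of_le {n : ℕ} (z : Fin (n + 1) → S) (w : S) {k : ℕ} (hk : k ≤ n) :
    tupleSeq (n := n + 1) (Fin.snoc z w : Fin (n + 2) → S) k = tupleSeq z k := by
  rw [tupleSeq_of_le _ (Nat.le_succ_of_le hk), tupleSeq_of_le _ hk, Fin.snoc,
    dif_pos (Nat.lt_succ_of_le hk)]
  rfl

lemma tupleSeq_snoc_last {n : ℕ} (z : Fin (n + 1) → S) (w : S) :
    tupleSeq (n := n + 1) (Fin.snoc z w : Fin (n + 2) → S) (n + 1) = w := by
  rw [tupleSeq_of_le _ le_rfl]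
  simp [Fin.snoc]

lemma exists_tupleSeq_eq (n : ℕ) (z : ℕ → S) :
    ∃ z' : Fin (n + 1) → S, ∀ k ≤ n, tupleSeq z' k = z k :=
  ⟨fun i => z i, fun k hk => by rw [tupleSeq_of_le _ hk]⟩

lemma tsum_snoc {n : ℕ} (F : (Fin (n + 2) → S) → ENNReal) :
    ∑' z, F z = ∑' (z : Fin (n + 1) → S) (w : S), F (Fin.snoc z w) := by
  rw [← (Fin.snocEquiv fun _ : Fin (n + 2) => S).tsum_eq, ENNReal.tsum_prod', ENNReal.tsum_comm]
  rfl

/-- The total weight of all paths of length `n` with given one-step weights. -/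
lemma tsum_path_prod_le (z₀ : S) (K : ℕ → S → S → ENNReal) (r : ℕ → ENNReal)
    (hK : ∀ i z, ∑' w, K i z w ≤ r i) (n : ℕ) :
    ∑' z : Fin (n + 1) → S, Set.indicator {z₀} 1 (tupleSeq z 0) *
      ∏ i ∈ Finset.range n, K i (tupleSeq z i) (tupleSeq z (i + 1)) ≤
      ∏ i ∈ Finset.range n, r i := by
  induction n with
  | zero =>
    rw [← (Equiv.funUnique (Fin 1) S).symm.tsum_eq]
    simp only [Finset.range_zero, Finset.prod_empty, mul_one]
    rw [tsum_eq_single z₀]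
    · exact Set.indicator_le_self' (fun _ _ => zero_le) _
    · intro b hb
      simpa [tupleSeq] using hb
  | succ n ih =>
    rw [tsum_snoc, Finset.prod_range_succ]
    -- The last state is summed out first; its bound does not depend on the state before it.
    refine le_trans ?_ (mul_le_mul_left ih _)
    rw [← ENNReal.tsum_mul_right]
    refine ENNReal.tsum_le_tsum fun z => ?_
    refine le_trans (le_of_eq ?_) (mul_le_mul_right (hK n (tupleSeq z n)) _)
    rw [← ENNReal.tsum_mul_left]
    refine tsum_congr fun w => ?_
    rw [Finset.prod_range_succ, tupleSeq_snoc_of_le _ _ (Nat.zero_le n),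
      tupleSeq_snoc_of_le _ _ le_rfl, tupleSeq_snoc_last, mul_assoc]
    congr 2
    refine Finset.prod_congr rfl fun i hi => ?_
    rw [Finset.mem_range] at hi
    rw [tupleSeq_snoc_of_le _ _ hi.le, tupleSeq_snoc_of_le _ _ hi]

end PathSums

/-! ### Exponential distributions -/

section Exponential

open ProbabilityTheory

lemma expMeasure_Ioi {r : ℝ} (hr : 0 < r) {s : ℝ} (hs : 0 ≤ s) :
    expMeasure r (Set.Ioi s) = ENNReal.ofReal (Real.exp (-(r * s))) := by
  have := isProbabilityMeasure_expMeasure hr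
  have h := cdf_expMeasure_eq hr s
  rw [if_pos hs, cdf_eq_real] at h
  rw [← ofReal_measureReal, ← Set.compl_Iic, probReal_compl_eq_one_sub measurableSet_Iic, h]
  congr 1
  ring

lemma expMeasure_Ioi_of_neg {r : ℝ} (hr : 0 < r) {s : ℝ} (hs : s ≤ 0) :
    expMeasure r (Set.Ioi s) = 1 := by
  have := isProbabilityMeasure_expMeasure hr
  refine le_antisymm prob_le_one ?_
  calc 1 = expMeasure r (Set.Ioi 0) := by rw [expMeasure_Ioi hr le_rfl]; simp
    _ ≤ _ := measure_mono (Set.Ioi_subset_Ioi hs)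

lemma expMeasure_eq_withDensity (r : ℝ) :
    expMeasure r = volume.withDensity (exponentialPDF r) := rfl

/-- Tilting the density of rate `r` by this exponential gives `r / θ` times the density of rate `θ`.
-/
lemma lintegral_exp_expMeasure {r θ : ℝ} (hr : 0 < r) (hθ : 0 < θ) :
    ∫⁻ s, ENNReal.ofReal (Real.exp ((r - θ) * s)) ∂(expMeasure r) = ENNReal.ofReal (r / θ) := by
  have hm : Measurable (exponentialPDF r) := (measurable_exponentialPDFReal r).ennreal_ofReal
  rw [expMeasure_eq_withDensity, lintegral_withDensity_eq_lintegral_mul _ hm (by fun_prop)]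
  have : ∀ s, (exponentialPDF r * fun s => ENNReal.ofReal (Real.exp ((r - θ) * s))) s =
      ENNReal.ofReal (r / θ) * exponentialPDF θ s := by
    intro s
    rcases lt_or_ge s 0 with hs | hs
    · simp [exponentialPDF_of_neg hs]
    · rw [Pi.mul_apply, exponentialPDF_of_nonneg hs, exponentialPDF_of_nonneg hs,
        ← ENNReal.ofReal_mul (by positivity), ← ENNReal.ofReal_mul (by positivity)]
      congr 1
      rw [mul_assoc, ← Real.exp_add]
      have h1 : -(r * s) + (r - θ) * s = -(θ * s) := by ring
      rw [h1]
      field_simp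
  have hm' : Measurable (exponentialPDF θ) := (measurable_exponentialPDFReal θ).ennreal_ofReal
  rw [lintegral_congr this, lintegral_const_mul _ hm', lintegral_exponentialPDF_eq_one hθ, mul_one]

end Exponential

/-! ### Law of the holding times along a given path -/

namespace IsJumpChain

open ProbabilityTheory

variable {lam : ℤ × ℤ → ℝ} {Ω : Type*} [MeasurableSpace Ω] {P : Measure Ω}
  {Y : ℕ → Ω → ℕ × ℕ} {τ : ℕ → Ω → ℝ}

lemma measurableSet_pos_path (hc : IsJumpChain lam P Y τ) (z : ℕ → ℕ × ℕ) (n : ℕ) :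
    MeasurableSet {ω | Y 0 ω = z 0 ∧ ∀ i < n, 0 < τ i ω ∧ Y (i + 1) ω = z (i + 1)} := by
  rw [show {ω | Y 0 ω = z 0 ∧ ∀ i < n, 0 < τ i ω ∧ Y (i + 1) ω = z (i + 1)} = Y 0 ⁻¹' {z 0} ∩
      ⋂ i, ⋂ (_ : i < n), (τ i ⁻¹' Set.Ioi 0 ∩ Y (i + 1) ⁻¹' {z (i + 1)}) by ext; simp]
  exact (hc.measurable_state 0 (measurableSet_singleton _)).inter
    (MeasurableSet.iInter fun i => MeasurableSet.iInter fun _ =>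
      (hc.measurable_holding i measurableSet_Ioi).inter
        (hc.measurable_state _ (measurableSet_singleton _)))

lemma measure_pos_path (hc : IsJumpChain lam P Y τ) (z : ℕ → ℕ × ℕ) (hz : z 0 = (0, 0)) (n : ℕ) :
    P {ω | Y 0 ω = z 0 ∧ ∀ i < n, 0 < τ i ω ∧ Y (i + 1) ω = z (i + 1)} =
      ENNReal.ofReal (∏ i ∈ Finset.range n, jumpProb lam (z i) (increment (z i) (z (i + 1)))) := by
  simpa using hc.law n z (fun _ => 0) hz (fun _ => le_rfl)

/-- The law with all thresholds zero, summed over the next state `w`, already gives the part with `0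
< τ n` the full mass of the path event, because the jump probabilities add up to one. -/
lemma measure_path_holding_nonpos (hlam : ∀ y ∈ jumpSet, 0 < lam y) [IsProbabilityMeasure P]
    (hc : IsJumpChain lam P Y τ) (z : ℕ → ℕ × ℕ) (hz : z 0 = (0, 0)) (n : ℕ) :
    P ({ω | Y 0 ω = z 0 ∧ ∀ i < n, 0 < τ i ω ∧ Y (i + 1) ω = z (i + 1)} ∩ {ω | τ n ω ≤ 0}) = 0 := by
  set A := {ω | Y 0 ω = z 0 ∧ ∀ i < n, 0 < τ i ω ∧ Y (i + 1) ω = z (i + 1)} with hA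
  let u : ℕ × ℕ → ℕ → ℕ × ℕ := fun w => Function.update z (n + 1) w
  have hu : ∀ w, ∀ i ≤ n, u w i = z i := fun w i hi =>
    Function.update_of_ne (by omega) _ _
  let D : ℕ × ℕ → Set Ω := fun w =>
    {ω | Y 0 ω = u w 0 ∧ ∀ i < n + 1, 0 < τ i ω ∧ Y (i + 1) ω = u w (i + 1)}
  have hsub : ⋃ w, D w ⊆ A \ {ω | τ n ω ≤ 0} := by
    refine Set.iUnion_subset fun w ω hω => ⟨⟨?_, fun i hi => ⟨(hω.2 i (by omega)).1, ?_⟩⟩, ?_⟩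
    · rw [hω.1, hu w 0 (Nat.zero_le n)]
    · rw [(hω.2 i (by omega)).2, hu w (i + 1) hi]
    · exact not_le.2 (hω.2 n (by omega)).1
  have hdisj : Pairwise (Function.onFun Disjoint D) := by
    intro w w' hww
    refine Set.disjoint_left.2 fun ω h1 h2 => hww ?_
    have e1 := (h1.2 n (by omega)).2
    have e2 := (h2.2 n (by omega)).2
    simpa [u, e1] using e2
  have hsum : ∑' w, P (D w) = P A := by
    have : ∀ w, P (D w) = P A * ENNReal.ofReal (jumpProb lam (z n) (increment (z n) w)) := by
      intro w
      rw [hc.measure_pos_path (u w) (by rw [hu w 0 (Nat.zero_le n), hz]) (n + 1), hA,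
        hc.measure_pos_path z hz n, Finset.prod_range_succ, ENNReal.ofReal_mul
          (Finset.prod_nonneg fun i _ => jumpProb_nonneg hlam _ _)]
      congr 2
      · refine Finset.prod_congr rfl fun i hi => ?_
        rw [Finset.mem_range] at hi
        rw [hu w i hi.le, hu w (i + 1) hi]
      · rw [hu w n le_rfl]
        simp [u]
    simp_rw [this]
    rw [ENNReal.tsum_mul_left, tsum_jumpProb hlam, mul_one]
  have hle : P A ≤ P (A \ {ω | τ n ω ≤ 0}) := by
    rw [← hsum, ← measure_iUnion hdisj fun w => hc.measurableSet_pos_path (u w) (n + 1)]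
    exact measure_mono hsub
  have hadd : P (A ∩ {ω | τ n ω ≤ 0}) + P (A \ {ω | τ n ω ≤ 0}) = P A :=
    measure_inter_add_sdiff (μ := P) A (hc.measurable_holding n measurableSet_Iic :
    MeasurableSet {ω | τ n ω ≤ 0})
  have hfin : P (A \ {ω | τ n ω ≤ 0}) ≠ ⊤ := measure_ne_top _ _
  refine le_antisymm ?_ zero_le
  refine (ENNReal.add_le_add_iff_right hfin).1 ?_
  rw [hadd, zero_add]
  exact hle

/-- By induction: the past follows one of countably many paths, and along each of them the
exceptional event is null. -/
lemma ae_start_and_holding_pos (hlam : ∀ y ∈ jumpSet, 0 < lam y) [IsProbabilityMeasure P]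
    (hc : IsJumpChain lam P Y τ) (n : ℕ) :
    ∀ᵐ ω ∂P, Y 0 ω = (0, 0) ∧ ∀ i < n, 0 < τ i ω := by
  induction n with
  | zero =>
    have h := hc.measure_pos_path (fun _ => (0, 0)) rfl 0
    simp only [Nat.not_lt_zero, false_imp_iff, implies_true, and_true, Finset.range_zero,
      Finset.prod_empty, ENNReal.ofReal_one] at h ⊢
    exact (prob_compl_eq_zero_iff (hc.measurable_state 0 (measurableSet_singleton _))).2 h
  | succ n ih =>
    have h : ∀ᵐ ω ∂P, ∀ z : Fin (n + 1) → ℕ × ℕ, tupleSeq z 0 = (0, 0) →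
        ¬ ((Y 0 ω = tupleSeq z 0 ∧ ∀ i < n, 0 < τ i ω ∧ Y (i + 1) ω = tupleSeq z (i + 1)) ∧
          τ n ω ≤ 0) := by
      refine ae_all_iff.2 fun z => ?_
      by_cases hz : tupleSeq z 0 = (0, 0)
      · have := hc.measure_path_holding_nonpos hlam (tupleSeq z) hz n
        filter_upwards [measure_eq_zero_iff_ae_notMem.1 this] with ω hω _ h
        exact hω h
      · exact Eventually.of_forall fun ω h0 => absurd h0 hz
    filter_upwards [ih, h] with ω h1 h2
    refine ⟨h1.1, fun i hi => ?_⟩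
    rcases Nat.lt_succ_iff_lt_or_eq.1 hi with hi | rfl
    · exact h1.2 i hi
    · obtain ⟨z, hz⟩ := exists_tupleSeq_eq i fun k => Y k ω
      by_contra hneg
      refine h2 z (by rw [hz 0 (Nat.zero_le _), h1.1]) ⟨⟨(hz 0 (Nat.zero_le _)).symm,
        fun k hk => ⟨h1.2 k hk, (hz (k + 1) hk).symm⟩⟩, not_lt.1 hneg⟩

lemma ae_start (hlam : ∀ y ∈ jumpSet, 0 < lam y) [IsProbabilityMeasure P]
    (hc : IsJumpChain lam P Y τ) : ∀ᵐ ω ∂P, Y 0 ω = (0, 0) :=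
  (hc.ae_start_and_holding_pos hlam 0).mono fun _ h => h.1

lemma ae_holding_pos (hlam : ∀ y ∈ jumpSet, 0 < lam y) [IsProbabilityMeasure P]
    (hc : IsJumpChain lam P Y τ) : ∀ᵐ ω ∂P, ∀ n, 0 < τ n ω :=
  ae_all_iff.2 fun n => (hc.ae_start_and_holding_pos hlam (n + 1)).mono fun _ h =>
    h.2 n (Nat.lt_succ_self n)

/-- On the event that the states follow a given path, the holding times are independent and
exponential. -/
lemma map_restrict_path (hlam : ∀ y ∈ jumpSet, 0 < lam y) [IsProbabilityMeasure P]
    (hc : IsJumpChain lam P Y τ) (z : ℕ → ℕ × ℕ) (hz : z 0 = (0, 0)) (n : ℕ) :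
    (P.restrict {ω | ∀ i ≤ n, Y i ω = z i}).map (fun ω (i : Fin n) => τ i ω) =
      Measure.pi fun i : Fin n => (jumpProb lam (z i) (increment (z i) (z (i + 1)))).toNNReal •
        expMeasure (totalRate lam (z i)) := by
  have hexp : ∀ i, IsProbabilityMeasure (expMeasure (totalRate lam (z i))) := fun i =>
    isProbabilityMeasure_expMeasure (totalRate_pos hlam _)
  symm
  refine Measure.pi_eq_generateFrom (C := fun _ => Set.range Set.Ioi)
    (fun i => ((BorelSpace.measurable_eq (α := ℝ)).trans (borel_eq_generateFrom_Ioi ℝ)).symm)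
    (fun _ => isPiSystem_Ioi)
    (fun i => ⟨fun k => Set.Ioi (-(k : ℝ)), fun k => ⟨_, rfl⟩, fun k => measure_lt_top _ _, ?_⟩) ?_
  · refine Set.eq_univ_of_forall fun x => Set.mem_iUnion.2 ?_
    obtain ⟨k, hk⟩ := exists_nat_gt (-x)
    exact ⟨k, by simp only [Set.mem_Ioi]; linarith⟩
  · intro s hs
    choose a ha using hs
    have hτ : Measurable fun ω (i : Fin n) => τ i ω :=
      measurable_pi_lambda _ fun i => hc.measurable_holding i
    have hms : MeasurableSet (Set.univ.pi s) :=
      MeasurableSet.univ_pi fun i => by rw [← ha i]; exact measurableSet_Ioi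
    rw [Measure.map_apply hτ hms, Measure.restrict_apply (hτ hms)]
    -- The law is available for nonnegative thresholds only; holding times being almost surely
    -- positive, negative thresholds may be raised to zero.
    let b : ℕ → ℝ := fun i => if h : i < n then max (a ⟨i, h⟩) 0 else 0
    have hb : ∀ i, 0 ≤ b i := by
      intro i
      by_cases h : i < n <;> simp [b, h]
    have key := hc.law n z b hz hb
    have hset : P ((fun ω (i : Fin n) => τ i ω) ⁻¹' Set.univ.pi s ∩ {ω | ∀ i ≤ n, Y i ω = z i}) =
        P {ω | Y 0 ω = z 0 ∧ ∀ i < n, b i < τ i ω ∧ Y (i + 1) ω = z (i + 1)} := by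
      refine measure_congr ?_
      filter_upwards [hc.ae_holding_pos hlam] with ω hω
      refine propext ⟨fun h => ⟨h.2 0 (Nat.zero_le _), fun i hi => ⟨?_, h.2 (i + 1) hi⟩⟩,
        fun h => ⟨fun i _ => ?_, fun i hi => ?_⟩⟩
      · have := h.1 ⟨i, hi⟩ trivial
        rw [← ha] at this
        simp only [b, dif_pos hi]
        exact max_lt this (hω i)
      · rw [← ha]
        have := (h.2 i i.2).1
        simp only [b, dif_pos i.2] at this
        exact lt_of_le_of_lt (le_max_left _ _) this
      · rcases Nat.eq_zero_or_pos i with rfl | h0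
        · exact h.1
        · have := (h.2 (i - 1) (by omega)).2
          rwa [Nat.sub_add_cancel h0] at this
    rw [hset, key, ENNReal.ofReal_prod_of_nonneg fun i _ => mul_nonneg (Real.exp_pos _).le
      (jumpProb_nonneg hlam _ _), Finset.prod_range]
    refine Finset.prod_congr rfl fun i _ => ?_
    rw [mul_comm, ENNReal.ofReal_mul (jumpProb_nonneg hlam _ _), ← ha i, Measure.smul_apply]
    have hpos := totalRate_pos hlam (z i)
    have : expMeasure (totalRate lam (z i)) (Set.Ioi (a i)) =
        ENNReal.ofReal (Real.exp (-(totalRate lam (z i) * b i))) := by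
      simp only [b, dif_pos i.2]
      rcases le_total (a i) 0 with h | h
      · rw [expMeasure_Ioi_of_neg hpos h, max_eq_right h]; simp
      · rw [expMeasure_Ioi hpos h, max_eq_left h]
    rw [this]
    rfl

/-- Exponential Chebyshev inequality for the holding times along a given path. -/
lemma measure_inter_path_le (hlam : ∀ y ∈ jumpSet, 0 < lam y) [IsProbabilityMeasure P]
    (hc : IsJumpChain lam P Y τ) (z : ℕ → ℕ × ℕ) (hz : z 0 = (0, 0)) (n : ℕ)
    (θ : ℕ → ℝ) (hθ : ∀ i, 0 < θ i) (k : ℝ) (B : Set Ω)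
    (hB : ∀ ω ∈ B, (∀ i ≤ n, Y i ω = z i) →
      k ≤ ∑ i ∈ Finset.range n, (totalRate lam (z i) - θ i) * τ i ω) :
    P (B ∩ {ω | ∀ i ≤ n, Y i ω = z i}) ≤ ENNReal.ofReal (Real.exp (-k)) *
      ∏ i ∈ Finset.range n,
        ENNReal.ofReal (jumpRate lam (z i) (increment (z i) (z (i + 1))) / θ i) := by
  set A := {ω | ∀ i ≤ n, Y i ω = z i} with hA
  have hexp : ∀ i, IsProbabilityMeasure (expMeasure (totalRate lam (z i))) := fun i =>
    isProbabilityMeasure_expMeasure (totalRate_pos hlam _)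
  have hτ : Measurable fun ω (i : Fin n) => τ i ω :=
    measurable_pi_lambda _ fun i => hc.measurable_holding i
  -- Each factor has expectation `totalRate / θ`, which turns `jumpProb` into `jumpRate / θ`.
  -- Markov's inequality for `G` then gives the claim.
  let G : (Fin n → ℝ) → ENNReal := fun s =>
    ∏ i : Fin n, ENNReal.ofReal (Real.exp ((totalRate lam (z i) - θ i) * s i))
  have hG : Measurable G := Finset.measurable_prod _ fun i _ => by fun_prop
  have hsmul : (Measure.pi fun i : Fin n =>
      (jumpProb lam (z i) (increment (z i) (z (i + 1)))).toNNReal •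
        expMeasure (totalRate lam (z i))) =
      (∏ i : Fin n, ENNReal.ofReal (jumpProb lam (z i) (increment (z i) (z (i + 1))))) •
        Measure.pi fun i : Fin n => expMeasure (totalRate lam (z i)) := by
    refine Measure.pi_eq fun s _ => ?_
    rw [Measure.smul_apply, Measure.pi_pi, smul_eq_mul, ← Finset.prod_mul_distrib]
    rfl
  have hint : ∫⁻ s, G s ∂((P.restrict A).map fun ω (i : Fin n) => τ i ω) =
      ∏ i ∈ Finset.range n,
        ENNReal.ofReal (jumpRate lam (z i) (increment (z i) (z (i + 1))) / θ i) := by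
    rw [hA, hc.map_restrict_path hlam z hz n, hsmul, lintegral_smul_measure, smul_eq_mul]
    have hind := iIndepFun_pi (μ := fun i : Fin n => expMeasure (totalRate lam (z i)))
      (X := fun i s => ENNReal.ofReal (Real.exp ((totalRate lam (z i) - θ i) * s)))
      (fun i => by fun_prop)
    rw [lintegral_prod_eq_prod_lintegral_of_indepFun Finset.univ _ hind
      (fun i => by fun_prop), ← Finset.prod_mul_distrib, Finset.prod_range]
    refine Finset.prod_congr rfl fun i _ => ?_
    have h1 := (measurePreserving_eval (fun i : Fin n => expMeasure (totalRate lam (z i))) i)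
    have h2 := h1.lintegral_comp (f := fun s : ℝ =>
      ENNReal.ofReal (Real.exp ((totalRate lam (z i) - θ i) * s))) (by fun_prop)
    have hpos := totalRate_pos hlam (z i)
    rw [h2, lintegral_exp_expMeasure hpos (hθ i),
      ← ENNReal.ofReal_mul (jumpProb_nonneg hlam _ _)]
    congr 1
    rw [jumpProb]
    field_simp
  have hsub : B ∩ A ⊆ (fun ω (i : Fin n) => τ i ω) ⁻¹' {s | ENNReal.ofReal (Real.exp k) ≤ G s} ∩
      A := by
    rintro ω ⟨hωB, hωA⟩
    refine ⟨?_, hωA⟩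
    have h := hB ω hωB hωA
    rw [Finset.sum_range fun i => (totalRate lam (z i) - θ i) * τ i ω] at h
    simp only [Set.mem_preimage, Set.mem_ofPred_eq, G]
    rw [← ENNReal.ofReal_prod_of_nonneg fun i _ => (Real.exp_pos _).le, ← Real.exp_sum]
    exact ENNReal.ofReal_le_ofReal (Real.exp_le_exp.2 h)
  have hms : MeasurableSet {s | ENNReal.ofReal (Real.exp k) ≤ G s} :=
    measurableSet_le measurable_const hG
  have hk : ENNReal.ofReal (Real.exp k) ≠ 0 := by simp [Real.exp_pos]
  calc P (B ∩ A) ≤ _ := measure_mono hsub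
    _ = ((P.restrict A).map fun ω (i : Fin n) => τ i ω) {s | ENNReal.ofReal (Real.exp k) ≤ G s} := by
        rw [Measure.map_apply hτ hms, Measure.restrict_apply (hτ hms)]
    _ ≤ (∫⁻ s, G s ∂((P.restrict A).map fun ω (i : Fin n) => τ i ω)) /
          ENNReal.ofReal (Real.exp k) :=
        meas_ge_le_lintegral_div hG.aemeasurable hk ENNReal.ofReal_ne_top
    _ = _ := by
        rw [hint, ENNReal.div_eq_inv_mul, Real.exp_neg, ENNReal.ofReal_inv_of_pos (Real.exp_pos k)]

/-- The probability that the states follow a given path, with all holding times in a given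
interval. -/
lemma measure_path_box (hlam : ∀ y ∈ jumpSet, 0 < lam y) [IsProbabilityMeasure P]
    (hc : IsJumpChain lam P Y τ) (z : ℕ → ℕ × ℕ) (hz : z 0 = (0, 0)) (n : ℕ)
    {a b : ℝ} (ha : 0 ≤ a) (hab : a ≤ b) :
    P {ω | (∀ i < n, τ i ω ∈ Set.Ioc a b) ∧ ∀ i ≤ n, Y i ω = z i} =
      ENNReal.ofReal (∏ i ∈ Finset.range n,
        (jumpProb lam (z i) (increment (z i) (z (i + 1))) *
          (Real.exp (-(totalRate lam (z i) * a)) - Real.exp (-(totalRate lam (z i) * b))))) := by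
  have hexp : ∀ i, IsProbabilityMeasure (expMeasure (totalRate lam (z i))) := fun i =>
    isProbabilityMeasure_expMeasure (totalRate_pos hlam _)
  have hτ : Measurable fun ω (i : Fin n) => τ i ω :=
    measurable_pi_lambda _ fun i => hc.measurable_holding i
  have hms : MeasurableSet (Set.univ.pi fun _ : Fin n => Set.Ioc a b) :=
    MeasurableSet.univ_pi fun _ => measurableSet_Ioc
  have hset : {ω | (∀ i < n, τ i ω ∈ Set.Ioc a b) ∧ ∀ i ≤ n, Y i ω = z i} =
      (fun ω (i : Fin n) => τ i ω) ⁻¹' (Set.univ.pi fun _ : Fin n => Set.Ioc a b) ∩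
        {ω | ∀ i ≤ n, Y i ω = z i} := by
    ext ω
    simp only [Set.mem_ofPred_eq, Set.mem_inter_iff, Set.mem_preimage, Set.mem_univ_pi]
    exact and_congr_left fun _ => ⟨fun h i => h i i.2, fun h i hi => h ⟨i, hi⟩⟩
  have hnn : ∀ i, 0 ≤ Real.exp (-(totalRate lam (z i) * a)) -
      Real.exp (-(totalRate lam (z i) * b)) := fun i =>
    sub_nonneg.2 (Real.exp_le_exp.2 (neg_le_neg (mul_le_mul_of_nonneg_left hab
      (totalRate_pos hlam _).le)))
  rw [hset, ← Measure.restrict_apply (hτ hms), ← Measure.map_apply hτ hms,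
    hc.map_restrict_path hlam z hz n, Measure.pi_pi, ENNReal.ofReal_prod_of_nonneg
      (fun i _ => mul_nonneg (jumpProb_nonneg hlam _ _) (hnn i)), Finset.prod_range]
  refine Finset.prod_congr rfl fun i _ => ?_
  have hpos := totalRate_pos hlam (z i)
  rw [ENNReal.ofReal_mul (jumpProb_nonneg hlam _ _), Measure.smul_apply,
    ← Set.Ioi_sdiff_Ioi, measure_sdiff (Set.Ioi_subset_Ioi hab) measurableSet_Ioi.nullMeasurableSet
      (measure_ne_top _ _), expMeasure_Ioi hpos ha, expMeasure_Ioi hpos (ha.trans hab),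
    ← ENNReal.ofReal_sub _ (Real.exp_pos _).le]
  rfl

end IsJumpChain

/-! ### The rate function and its infimum over a neighbourhood -/

/-- The integrand of the rate function. -/
def pointCost (lam : ℤ × ℤ → ℝ) (v : EuclideanSpace ℝ (Fin 2)) : ℝ :=
  lam (-1, 0) * v 0 + lam (0, -1) * v 1 + lam (-1, -1) * min (v 0) (v 1)

lemma rateFunction_eq (lam : ℤ × ℤ → ℝ) (x : unitInterval → EuclideanSpace ℝ (Fin 2)) :
    rateFunction lam x = ∫ t, pointCost lam (x t) := rfl

lemma continuous_pointCost (lam : ℤ × ℤ → ℝ) : Continuous (pointCost lam) := by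
  unfold pointCost
  fun_prop

/-- The cost is homogeneous of degree one; together with the rescaling of time this produces the
factor `T ^ 2`. -/
lemma pointCost_scaled (lam : ℤ × ℤ → ℝ) (z : ℕ × ℕ) {T : ℝ} (hT : 0 < T) :
    pointCost lam !₂[(z.1 : ℝ) / T, (z.2 : ℝ) / T] = stateCost lam z / T := by
  simp only [pointCost, stateCost]
  simp [min_div_div_right hT.le]
  field_simp

lemma abs_apply_sub_le (v w : EuclideanSpace ℝ (Fin 2)) (i : Fin 2) : |v i - w i| ≤ ‖v - w‖ := by
  have := PiLp.norm_apply_le (v - w) i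
  simpa using this

/-- A Lipschitz constant of the integrand of the rate function. -/
def costLip (lam : ℤ × ℤ → ℝ) : ℝ := lam (-1, 0) + lam (0, -1) + lam (-1, -1)

section Positive

variable {lam : ℤ × ℤ → ℝ} (hlam : ∀ y ∈ jumpSet, 0 < lam y)
include hlam

lemma costLip_pos : 0 < costLip lam := by
  have h3 := hlam (-1, 0) (by decide)
  have h4 := hlam (0, -1) (by decide)
  have h5 := hlam (-1, -1) (by decide)
  unfold costLip
  positivity

lemma abs_pointCost_sub_le (v w : EuclideanSpace ℝ (Fin 2)) :
    |pointCost lam v - pointCost lam w| ≤ costLip lam * ‖v - w‖ := by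
  have h3 := hlam (-1, 0) (by decide)
  have h4 := hlam (0, -1) (by decide)
  have h5 := hlam (-1, -1) (by decide)
  have e0 := abs_apply_sub_le v w 0
  have e1 := abs_apply_sub_le v w 1
  have e2 : |min (v 0) (v 1) - min (w 0) (w 1)| ≤ ‖v - w‖ :=
    (abs_min_sub_min_le_max _ _ _ _).trans (max_le e0 e1)
  rw [show pointCost lam v - pointCost lam w = lam (-1, 0) * (v 0 - w 0) +
    lam (0, -1) * (v 1 - w 1) + lam (-1, -1) * (min (v 0) (v 1) - min (w 0) (w 1)) by
      simp only [pointCost]; ring]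
  refine (abs_add_three _ _ _).trans ?_
  rw [abs_mul, abs_mul, abs_mul, abs_of_pos h3, abs_of_pos h4, abs_of_pos h5, costLip, add_mul,
    add_mul]
  gcongr

lemma abs_pointCost_le (v : EuclideanSpace ℝ (Fin 2)) :
    |pointCost lam v| ≤ costLip lam * ‖v‖ := by
  simpa [pointCost] using abs_pointCost_sub_le hlam v 0

end Positive

/-- Such a path is continuous off a finite set, and changing values on a countable set preserves
measurability. -/
lemma measurable_of_mem_pathSpace {x : unitInterval → EuclideanSpace ℝ (Fin 2)}
    (hx : x ∈ pathSpace) : Measurable x := by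
  classical
  obtain ⟨-, -, -, -, hfin⟩ := hx
  set D := {t | ¬ ContinuousAt x t}
  have h1 : ContinuousOn x Dᶜ := fun t ht => by
    have : ContinuousAt x t := not_not.1 ht
    exact this.continuousWithinAt
  have h2 : Measurable (Dᶜ.piecewise x (fun _ => 0)) :=
    h1.measurable_piecewise continuousOn_const hfin.measurableSet.compl
  refine h2.measurable_of_countable_ne (hfin.countable.mono fun t ht => ?_)
  by_contra h
  exact ht (Set.piecewise_eq_of_mem _ _ _ h)

/-- The gap between `ε'` and `ε` is the room in which a path is later smoothed and discretized. -/
lemma exists_dist_le_of_mem_uniformNhd {f x : unitInterval → EuclideanSpace ℝ (Fin 2)} {ε : ℝ}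
    (hx : x ∈ uniformNhd f ε) : ∃ ε' < ε, ∀ t, ‖x t - f t‖ ≤ ε' := by
  obtain ⟨-, h⟩ := hx
  have hpos : 0 < ε := ENNReal.ofReal_pos.1 (zero_le.trans_lt h)
  have hne : uniformDist f x ≠ ⊤ := h.ne_top
  refine ⟨(uniformDist f x).toReal, ?_, fun t => ?_⟩
  · rw [← ENNReal.toReal_ofReal hpos.le]
    exact (ENNReal.toReal_lt_toReal hne ENNReal.ofReal_ne_top).2 h
  · rw [← dist_eq_norm, dist_comm, dist_edist]
    exact ENNReal.toReal_mono hne (le_iSup (fun t => edist (f t) (x t)) t)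

lemma mem_uniformNhd_of_dist_le {f x : unitInterval → EuclideanSpace ℝ (Fin 2)} {ε ε' : ℝ}
    (hx : x ∈ pathSpace) (h : ε' < ε) (hdist : ∀ t, ‖x t - f t‖ ≤ ε') : x ∈ uniformNhd f ε := by
  have hpos : 0 < ε := (norm_nonneg _).trans_lt ((hdist 0).trans_lt h)
  refine ⟨hx, lt_of_le_of_lt (iSup_le fun t => ?_) ((ENNReal.ofReal_lt_ofReal_iff hpos).2 h)⟩
  rw [edist_dist, dist_comm, dist_eq_norm]
  exact ENNReal.ofReal_le_ofReal (hdist t)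

lemma self_mem_uniformNhd {f : unitInterval → EuclideanSpace ℝ (Fin 2)} (hf : f ∈ excursionSet)
    {ε : ℝ} (hε : 0 < ε) : f ∈ uniformNhd f ε :=
  mem_uniformNhd_of_dist_le hf.1 hε fun t => by simp

lemma exists_norm_le_of_mem_excursionSet {f : unitInterval → EuclideanSpace ℝ (Fin 2)}
    (hf : f ∈ excursionSet) : ∃ M, 0 < M ∧ ∀ t, ‖f t‖ ≤ M := by
  obtain ⟨M, hM⟩ := isCompact_univ.exists_bound_of_continuousOn hf.2.1.continuousOn
  exact ⟨max M 1, by positivity, fun t => (hM t trivial).trans (le_max_left _ _)⟩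

lemma exists_norm_le_of_mem_uniformNhd {f : unitInterval → EuclideanSpace ℝ (Fin 2)}
    (hf : f ∈ excursionSet) (ε : ℝ) : ∃ M, 0 < M ∧ ∀ x ∈ uniformNhd f ε, ∀ t, ‖x t‖ ≤ M := by
  obtain ⟨M, hM, h⟩ := exists_norm_le_of_mem_excursionSet hf
  refine ⟨M + |ε|, by positivity, fun x hx t => ?_⟩
  obtain ⟨ε', hε', hd⟩ := exists_dist_le_of_mem_uniformNhd hx
  calc ‖x t‖ = ‖f t + (x t - f t)‖ := by congr 1; abel
    _ ≤ ‖f t‖ + ‖x t - f t‖ := norm_add_le _ _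
    _ ≤ M + |ε| := add_le_add (h t) ((hd t).trans (hε'.le.trans (le_abs_self ε)))

section Positive

variable {lam : ℤ × ℤ → ℝ} (hlam : ∀ y ∈ jumpSet, 0 < lam y)
include hlam

lemma integrable_pointCost {x : unitInterval → EuclideanSpace ℝ (Fin 2)} (hx : Measurable x)
    {M : ℝ} (hM : ∀ t, ‖x t‖ ≤ M) : Integrable fun t => pointCost lam (x t) := by
  refine Integrable.of_bound
    ((continuous_pointCost lam).measurable.comp hx).aestronglyMeasurable (costLip lam * M) ?_
  exact Eventually.of_forall fun t => (abs_pointCost_le hlam _).trans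
    (mul_le_mul_of_nonneg_left (hM t) (costLip_pos hlam).le)

lemma abs_rateFunction_sub_le {f x : unitInterval → EuclideanSpace ℝ (Fin 2)}
    (hf : f ∈ excursionSet) {ε : ℝ} (hx : x ∈ uniformNhd f ε) :
    |rateFunction lam x - rateFunction lam f| ≤ costLip lam * ε := by
  obtain ⟨M, -, hM⟩ := exists_norm_le_of_mem_uniformNhd hf ε
  obtain ⟨M', -, hM'⟩ := exists_norm_le_of_mem_excursionSet hf
  obtain ⟨ε', hε', hd⟩ := exists_dist_le_of_mem_uniformNhd hx
  rw [rateFunction_eq, rateFunction_eq, ← integral_sub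
    (integrable_pointCost hlam (measurable_of_mem_pathSpace hx.1) (hM x hx))
    (integrable_pointCost hlam (measurable_of_mem_pathSpace hf.1) hM')]
  have h : ∀ t, ‖pointCost lam (x t) - pointCost lam (f t)‖ ≤ costLip lam * ε := fun t =>
    (abs_pointCost_sub_le hlam _ _).trans
      (mul_le_mul_of_nonneg_left ((hd t).trans hε'.le) (costLip_pos hlam).le)
  simpa using norm_integral_le_of_norm_le_const (μ := (volume : Measure unitInterval))
    (Eventually.of_forall h)

lemma rateFunction_nonneg {x : unitInterval → EuclideanSpace ℝ (Fin 2)} (hx : x ∈ pathSpace) :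
    0 ≤ rateFunction lam x := by
  have h3 := (hlam (-1, 0) (by decide)).le
  have h4 := (hlam (0, -1) (by decide)).le
  have h5 := (hlam (-1, -1) (by decide)).le
  refine integral_nonneg fun t => ?_
  have e0 := hx.2.1 t 0
  have e1 := hx.2.1 t 1
  exact add_nonneg (add_nonneg (mul_nonneg h3 e0) (mul_nonneg h4 e1))
    (mul_nonneg h5 (le_min e0 e1))

/-- The infimum of the rate function over a neighbourhood. -/
def infRate (lam : ℤ × ℤ → ℝ) (f : unitInterval → EuclideanSpace ℝ (Fin 2)) (ε : ℝ) : ℝ :=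
  sInf (rateFunction lam '' uniformNhd f ε)

lemma infRate_le {f x : unitInterval → EuclideanSpace ℝ (Fin 2)} {ε : ℝ}
    (hx : x ∈ uniformNhd f ε) : infRate lam f ε ≤ rateFunction lam x := by
  refine csInf_le ⟨0, ?_⟩ (Set.mem_image_of_mem _ hx)
  rintro _ ⟨y, hy, rfl⟩
  exact rateFunction_nonneg hlam hy.1

omit hlam in
lemma exists_rateFunction_lt {f : unitInterval → EuclideanSpace ℝ (Fin 2)} (hf : f ∈ excursionSet)
    {ε δ : ℝ} (hε : 0 < ε) (hδ : 0 < δ) :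
    ∃ x ∈ uniformNhd f ε, rateFunction lam x < infRate lam f ε + δ := by
  obtain ⟨_, ⟨x, hx, rfl⟩, h⟩ := exists_lt_of_csInf_lt
    (Set.Nonempty.image (rateFunction lam) ⟨f, self_mem_uniformNhd hf hε⟩)
    (show infRate lam f ε < infRate lam f ε + δ by linarith)
  exact ⟨x, hx, h⟩

/-- Squeeze: `f` itself is a competitor, and the Lipschitz integrand allows a gain of at most
`costLip lam * ε`. -/
lemma tendsto_infRate {f : unitInterval → EuclideanSpace ℝ (Fin 2)} (hf : f ∈ excursionSet) :
    Tendsto (infRate lam f) (𝓝[>] 0) (𝓝 (rateFunction lam f)) := by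
  have hlow : Tendsto (fun ε : ℝ => rateFunction lam f - costLip lam * ε) (𝓝[>] 0)
      (𝓝 (rateFunction lam f)) := by
    have : Continuous fun ε : ℝ => rateFunction lam f - costLip lam * ε := by fun_prop
    simpa using (this.tendsto 0).mono_left nhdsWithin_le_nhds
  refine tendsto_of_tendsto_of_tendsto_of_le_of_le' hlow tendsto_const_nhds ?_ ?_
  · filter_upwards [self_mem_nhdsWithin] with ε hε
    refine le_csInf (Set.Nonempty.image _ ⟨f, self_mem_uniformNhd hf hε⟩) ?_
    rintro _ ⟨x, hx, rfl⟩
    have := abs_le.1 (abs_rateFunction_sub_le hlam hf hx)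
    linarith [this.1]
  · filter_upwards [self_mem_nhdsWithin] with ε hε
    exact infRate_le hlam (self_mem_uniformNhd hf hε)

end Positive

/-- Exponential bounds on both sides give the limit of the normalized logarithm. -/
lemma tendsto_log_of_exp_bounds {p : ℝ → ℝ} {J : ℝ}
    (hlow : ∀ δ > 0, ∀ᶠ T : ℝ in atTop, Real.exp (-(T ^ 2 * (J + δ))) ≤ p T)
    (hup : ∀ δ > 0, ∀ᶠ T : ℝ in atTop, p T ≤ Real.exp (-(T ^ 2 * (J - δ)))) :
    (∀ᶠ T : ℝ in atTop, 0 < p T) ∧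
      Tendsto (fun T : ℝ => 1 / T ^ 2 * Real.log (p T)) atTop (𝓝 (-J)) := by
  refine ⟨(hlow 1 one_pos).mono fun T h => (Real.exp_pos _).trans_le h, ?_⟩
  rw [Metric.tendsto_nhds]
  intro δ hδ
  filter_upwards [hlow (δ / 2) (half_pos hδ), hup (δ / 2) (half_pos hδ), eventually_gt_atTop 0]
    with T h1 h2 hT
  have hp : 0 < p T := (Real.exp_pos _).trans_le h1
  have h3 := (Real.le_log_iff_exp_le hp).2 h1
  have h4 := (Real.log_le_iff_le_exp hp).2 h2
  have hT2 : 0 < T ^ 2 := by positivity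
  rw [Real.dist_eq, abs_lt, one_div_mul_eq_div]
  constructor
  · rw [lt_sub_iff_add_lt, lt_div_iff₀ hT2]
    nlinarith
  · rw [sub_lt_iff_lt_add, div_lt_iff₀ hT2]
    nlinarith

/-! ### Step paths and their cost -/

/-- The rescaling of a path with values in the lattice. -/
def rescaledPath (η : ℝ → ℕ × ℕ) (T : ℝ) : unitInterval → EuclideanSpace ℝ (Fin 2) :=
  fun t => !₂[((η ((t : ℝ) * T)).1 : ℝ) / T, ((η ((t : ℝ) * T)).2 : ℝ) / T]

lemma scaledPath_eq_rescaledPath {Ω : Type*} (ξ : ℝ → Ω → ℕ × ℕ) (T : ℝ) (ω : Ω) :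
    scaledPath ξ T ω = rescaledPath (fun t => ξ t ω) T := rfl

/-- `η` takes the value `y n` between the `n`-th jump time and the next one. -/
def IsStepPath (y : ℕ → ℕ × ℕ) (s : ℕ → ℝ) (η : ℝ → ℕ × ℕ) : Prop :=
  ∀ (n : ℕ) (t : ℝ), ∑ i ∈ Finset.range n, s i ≤ t → t < ∑ i ∈ Finset.range (n + 1), s i → η t = y n

lemma exists_partial_sum_le_lt {s : ℕ → ℝ} {N : ℕ} {t : ℝ} (h0 : 0 ≤ t)
    (ht : t < ∑ i ∈ Finset.range N, s i) :
    ∃ k < N, ∑ i ∈ Finset.range k, s i ≤ t ∧ t < ∑ i ∈ Finset.range (k + 1), s i := by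
  induction N with
  | zero => simp at ht; linarith
  | succ N ih =>
    rcases lt_or_ge t (∑ i ∈ Finset.range N, s i) with h | h
    · obtain ⟨k, hk, h'⟩ := ih h
      exact ⟨k, by omega, h'⟩
    · exact ⟨N, by omega, h, ht⟩

/-- The variant with the strict inequality on the left, needed for left limits at jump times. -/
lemma exists_partial_sum_lt_le {s : ℕ → ℝ} {N : ℕ} {t : ℝ} (h0 : 0 < t)
    (ht : t ≤ ∑ i ∈ Finset.range N, s i) :
    ∃ k < N, ∑ i ∈ Finset.range k, s i < t ∧ t ≤ ∑ i ∈ Finset.range (k + 1), s i := by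
  induction N with
  | zero => simp at ht; linarith
  | succ N ih =>
    rcases le_or_gt t (∑ i ∈ Finset.range N, s i) with h | h
    · obtain ⟨k, hk, h'⟩ := ih h
      exact ⟨k, by omega, h'⟩
    · exact ⟨N, by omega, h, ht⟩

/-- The bound `hN` rules out infinitely many jumps up to time `T`, so the path consists of finitely
many constant pieces. -/
lemma rescaledPath_mem_pathSpace {y : ℕ → ℕ × ℕ} {s : ℕ → ℝ} {η : ℝ → ℕ × ℕ}
    (hη : IsStepPath y s η) (hs : 0 < s 0) (hy : y 0 = (0, 0)) {T : ℝ} (hT : 0 < T) {N : ℕ}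
    (hN : T < ∑ i ∈ Finset.range N, s i) : rescaledPath η T ∈ pathSpace := by
  have hcont : ∀ t : unitInterval, ContinuousAt (fun u : unitInterval => (u : ℝ) * T) t :=
    fun t => by fun_prop
  have hle : ∀ t : unitInterval, 0 ≤ (t : ℝ) * T ∧ (t : ℝ) * T < ∑ i ∈ Finset.range N, s i :=
    fun t => ⟨mul_nonneg t.2.1 hT.le, (mul_le_of_le_one_left hT.le t.2.2).trans_lt hN⟩
  have hval : ∀ (u : unitInterval) (n : ℕ), ∑ i ∈ Finset.range n, s i ≤ (u : ℝ) * T →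
      (u : ℝ) * T < ∑ i ∈ Finset.range (n + 1), s i →
      rescaledPath η T u = !₂[((y n).1 : ℝ) / T, ((y n).2 : ℝ) / T] := by
    intro u n h1 h2
    simp only [rescaledPath, hη n _ h1 h2]
  refine ⟨?_, fun t i => ?_, fun t => ?_, fun t => ?_, ?_⟩
  · have h0 : η 0 = (0, 0) := by rw [hη 0 0 (by simp) (by simpa using hs), hy]
    ext i
    fin_cases i <;> simp [rescaledPath, h0]
  · fin_cases i <;> simp [rescaledPath] <;> positivity
  · obtain ⟨k, hk, h1, h2⟩ := exists_partial_sum_le_lt (hle t).1 (hle t).2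
    refine Tendsto.congr' (f₁ := fun _ => rescaledPath η T t) ?_ tendsto_const_nhds
    filter_upwards [self_mem_nhdsWithin, mem_nhdsWithin_of_mem_nhds
      ((hcont t).eventually (gt_mem_nhds h2))] with u hu1 hu2
    rw [hval t k h1 h2, hval u k (h1.trans (mul_le_mul_of_nonneg_right hu1 hT.le)) hu2]
  · rcases eq_or_lt_of_le (show 0 ≤ (t : ℝ) from t.2.1) with h0 | h0
    · refine ⟨0, ?_⟩
      have : Set.Iio t = ∅ := by
        ext u
        simp only [Set.mem_Iio, Set.mem_empty_iff_false, iff_false, not_lt]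
        exact Subtype.coe_le_coe.1 (h0 ▸ u.2.1)
      rw [this, nhdsWithin_empty]
      exact tendsto_bot
    · obtain ⟨k, hk, h1, h2⟩ := exists_partial_sum_lt_le (mul_pos h0 hT) (hle t).2.le
      refine ⟨_, Tendsto.congr' (f₁ := fun _ => !₂[((y k).1 : ℝ) / T, ((y k).2 : ℝ) / T]) ?_
        tendsto_const_nhds⟩
      filter_upwards [self_mem_nhdsWithin, mem_nhdsWithin_of_mem_nhds
        ((hcont t).eventually (lt_mem_nhds h1))] with u hu1 hu2
      rw [hval u k hu2.le ((mul_lt_mul_of_pos_right hu1 hT).trans_le h2)]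
  · refine Set.Finite.subset (s := ⋃ k ∈ Finset.range N,
      {t : unitInterval | ∑ i ∈ Finset.range k, s i = (t : ℝ) * T}) ?_ ?_
    · refine Set.Finite.biUnion (Finset.finite_toSet _) fun k _ => Set.Subsingleton.finite ?_
      intro t ht u hu
      exact Subtype.ext (mul_right_cancel₀ hT.ne' ((ht : _ = _).symm.trans hu))
    · intro t ht
      by_contra hnot
      apply ht
      obtain ⟨k, hk, h1, h2⟩ := exists_partial_sum_le_lt (hle t).1 (hle t).2
      have h1' : ∑ i ∈ Finset.range k, s i < (t : ℝ) * T := by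
        refine lt_of_le_of_ne h1 fun h => hnot ?_
        exact Set.mem_biUnion (Finset.mem_coe.2 (Finset.mem_range.2 hk)) h
      refine Tendsto.congr' (f₁ := fun _ => rescaledPath η T t) ?_ tendsto_const_nhds
      filter_upwards [(hcont t).eventually (lt_mem_nhds h1'),
        (hcont t).eventually (gt_mem_nhds h2)] with u hu1 hu2
      rw [hval t k h1 h2, hval u k hu1.le hu2]

/-- The right end `b` is free because the last piece of a trajectory is cut off at time `T`. -/
lemma intervalIntegral_stateCost_of_isStepPath (lam : ℤ × ℤ → ℝ) {y : ℕ → ℕ × ℕ} {s : ℕ → ℝ}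
    {η : ℝ → ℕ × ℕ} (hη : IsStepPath y s η) {n : ℕ} {b : ℝ}
    (h1 : ∑ i ∈ Finset.range n, s i ≤ b) (h2 : b ≤ ∑ i ∈ Finset.range (n + 1), s i) :
    IntervalIntegrable (fun t => stateCost lam (η t)) volume (∑ i ∈ Finset.range n, s i) b ∧
      ∫ t in (∑ i ∈ Finset.range n, s i)..b, stateCost lam (η t) =
        stateCost lam (y n) * (b - ∑ i ∈ Finset.range n, s i) := by
  have heq : Set.EqOn (fun t => stateCost lam (η t)) (fun _ => stateCost lam (y n))
      (Set.Ioo (∑ i ∈ Finset.range n, s i) b) := fun t ht => by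
    simp only [hη n t ht.1.le (ht.2.trans_le h2)]
  constructor
  · refine (intervalIntegrable_congr_uIoo ?_).2 (intervalIntegrable_const
      (c := stateCost lam (y n)))
    rwa [Set.uIoo_of_le h1]
  · rw [intervalIntegral.integral_congr_Ioo_of_le h1 heq, intervalIntegral.integral_const,
      smul_eq_mul, mul_comm]

/-- The rate function of a rescaled step path in terms of holding times. -/
lemma rateFunction_rescaledPath (lam : ℤ × ℤ → ℝ) {y : ℕ → ℕ × ℕ} {s : ℕ → ℝ}
    {η : ℝ → ℕ × ℕ} (hη : IsStepPath y s η) (hs : ∀ i, 0 ≤ s i) {T : ℝ} (hT : 0 < T) {n : ℕ}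
    (h1 : ∑ i ∈ Finset.range n, s i ≤ T) (h2 : T ≤ ∑ i ∈ Finset.range (n + 1), s i) :
    T ^ 2 * rateFunction lam (rescaledPath η T) = ∑ i ∈ Finset.range n, stateCost lam (y i) * s i +
      stateCost lam (y n) * (T - ∑ i ∈ Finset.range n, s i) := by
  have e1 : rateFunction lam (rescaledPath η T) =
      ∫ t in (0 : ℝ)..1, stateCost lam (η (t * T)) / T := by
    rw [rateFunction_eq, intervalIntegral.integral_of_le zero_le_one,
      ← integral_Icc_eq_integral_Ioc, ← integral_subtype measurableSet_Icc]
    exact integral_congr_ae (Eventually.of_forall fun t => pointCost_scaled lam _ hT)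
  rw [e1, intervalIntegral.integral_div,
    intervalIntegral.integral_comp_mul_right (fun t => stateCost lam (η t)) hT.ne', zero_mul,
    one_mul, smul_eq_mul]
  have hpiece : ∀ k, _ := fun k => intervalIntegral_stateCost_of_isStepPath lam hη
    (n := k) (b := ∑ i ∈ Finset.range (k + 1), s i)
    (Finset.sum_le_sum_of_subset_of_nonneg (Finset.range_mono (Nat.le_succ k))
      fun i _ _ => hs i) le_rfl
  have hlast := intervalIntegral_stateCost_of_isStepPath lam hη h1 h2
  have hsum := intervalIntegral.sum_integral_adjacent_intervals (n := n)
    (a := fun k => ∑ i ∈ Finset.range k, s i) fun k _ => (hpiece k).1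
  have hint := IntervalIntegrable.trans_iterate (n := n)
    (a := fun k => ∑ i ∈ Finset.range k, s i) fun k _ => (hpiece k).1
  simp only [Finset.range_zero, Finset.sum_empty] at hsum hint
  rw [← intervalIntegral.integral_add_adjacent_intervals hint hlast.1, ← hsum, hlast.2]
  rw [show T ^ 2 * (T⁻¹ * ((∑ k ∈ Finset.range n, ∫ t in (∑ i ∈ Finset.range k, s i)..
    (∑ i ∈ Finset.range (k + 1), s i), stateCost lam (η t)) + stateCost lam (y n) *
      (T - ∑ i ∈ Finset.range n, s i)) / T) = (∑ k ∈ Finset.range n,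
      ∫ t in (∑ i ∈ Finset.range k, s i)..(∑ i ∈ Finset.range (k + 1), s i),
        stateCost lam (η t)) + stateCost lam (y n) * (T - ∑ i ∈ Finset.range n, s i) by
      field_simp]
  congr 1
  refine Finset.sum_congr rfl fun k _ => ?_
  rw [(hpiece k).2, Finset.sum_range_succ]
  ring

/-! ### One-step sums of weighted intensities -/

section Weights

variable {lam : ℤ × ℤ → ℝ} (hlam : ∀ y ∈ jumpSet, 0 < lam y)
include hlam

lemma stateCost_le {z : ℕ × ℕ} {R : ℝ} (h1 : (z.1 : ℝ) ≤ R) (h2 : (z.2 : ℝ) ≤ R) :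
    stateCost lam z ≤ costLip lam * R := by
  have h3 := (hlam (-1, 0) (by decide)).le
  have h4 := (hlam (0, -1) (by decide)).le
  have h5 := (hlam (-1, -1) (by decide)).le
  rw [costLip, add_mul, add_mul, stateCost]
  have := (min_le_left (z.1 : ℝ) z.2).trans h1
  gcongr

/-- Weighting the jumps by a power of the change in the sum of the coordinates compensates for
the imbalance between births, of bounded intensity, and deaths. -/
lemma tsum_weighted_jumpRate_le {z : ℕ × ℕ} {r M : ℝ} (hr : 1 ≤ r) (hM : 0 ≤ M)
    (h1 : (z.1 : ℝ) ≤ M * r ^ 2) (h2 : (z.2 : ℝ) ≤ M * r ^ 2) :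
    ∑' w, ENNReal.ofReal (jumpRate lam z (increment z w) /
        (2 * (lam (1, 0) + lam (0, 1) + costLip lam * M) * r) *
        r ^ ((increment z w).1 + (increment z w).2)) ≤ ENNReal.ofReal (1 / 2) := by
  have l1 := hlam (1, 0) (by decide)
  have l2 := hlam (0, 1) (by decide)
  have l3 := hlam (-1, 0) (by decide)
  have l4 := hlam (0, -1) (by decide)
  have l5 := hlam (-1, -1) (by decide)
  have hr0 : 0 < r := by linarith
  have hA : 0 < lam (1, 0) + lam (0, 1) + costLip lam * M := by
    have := (costLip_pos hlam).le
    positivity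
  set A := lam (1, 0) + lam (0, 1) + costLip lam * M with hAdef
  rw [tsum_increment (lam := lam) z fun y => ENNReal.ofReal (jumpRate lam z y / (2 * A * r) *
    r ^ (y.1 + y.2))]
  · rw [← ENNReal.ofReal_sum_of_nonneg fun y _ => mul_nonneg
      (div_nonneg (jumpRate_nonneg hlam z y) (by positivity)) (by positivity)]
    refine ENNReal.ofReal_le_ofReal ?_
    have hmul : ∀ y, jumpRate lam z y / (2 * A * r) * r ^ (y.1 + y.2) =
        jumpRate lam z y * r ^ (y.1 + y.2) / (2 * A * r) := fun y => by ring
    simp_rw [hmul]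
    rw [← Finset.sum_div, div_le_iff₀ (by positivity), sum_jumpSet]
    -- A simultaneous death lowers the sum by two; treating it as a loss of one is enough.
    have e2 : r ^ (-2 : ℤ) ≤ r⁻¹ := by
      rw [← zpow_neg_one]
      exact zpow_le_zpow_right₀ hr (by norm_num)
    -- Deaths have intensity of order `r ^ 2` and weight at most `r⁻¹`, births intensity of order 1
    -- and weight `r`: both contribute order `r`, at most `A * r` in all.
    have e1 : stateCost lam z * r⁻¹ ≤ costLip lam * M * r := by
      rw [← div_eq_mul_inv, div_le_iff₀ hr0]
      refine (stateCost_le hlam h1 h2).trans (le_of_eq ?_)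
      ring
    have e3 : lam (-1, -1) * min (z.1 : ℝ) z.2 * r ^ (-2 : ℤ) ≤
        lam (-1, -1) * min (z.1 : ℝ) z.2 * r⁻¹ :=
      mul_le_mul_of_nonneg_left e2 (by positivity)
    simp only [jumpRate, Prod.mk.injEq]
    norm_num
    have e4 : stateCost lam z * r⁻¹ = lam (-1, 0) * z.1 * r⁻¹ + lam (0, -1) * z.2 * r⁻¹ +
      lam (-1, -1) * min (z.1 : ℝ) z.2 * r⁻¹ := by rw [stateCost]; ring
    norm_num at e3
    rw [hAdef]
    nlinarith [e1, e3, e4]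
  · intro y hy
    simp [hy]

lemma tsum_jumpRate_div_le {z : ℕ × ℕ} {a R : ℝ} (ha : 0 < a) (h1 : (z.1 : ℝ) ≤ R)
    (h2 : (z.2 : ℝ) ≤ R) :
    ∑' w, ENNReal.ofReal (jumpRate lam z (increment z w) / a) ≤
      ENNReal.ofReal ((lam (1, 0) + lam (0, 1) + costLip lam * R) / a) := by
  rw [tsum_increment (lam := lam) z fun y => ENNReal.ofReal (jumpRate lam z y / a)]
  · rw [← ENNReal.ofReal_sum_of_nonneg fun y _ => div_nonneg (jumpRate_nonneg hlam z y) ha.le,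
      ← Finset.sum_div, ← totalRate, totalRate_eq]
    have := stateCost_le hlam h1 h2
    refine ENNReal.ofReal_le_ofReal ?_
    gcongr
  · intro y hy
    simp [hy]

-- The exponents telescope.
omit hlam in
lemma prod_zpow_increment (r : ℝ) (hr : r ≠ 0) (z : ℕ → ℕ × ℕ) (n : ℕ) :
    ∏ i ∈ Finset.range n, r ^ ((increment (z i) (z (i + 1))).1 + (increment (z i) (z (i + 1))).2) =
      r ^ (((z n).1 + (z n).2 : ℤ) - ((z 0).1 + (z 0).2)) := by
  induction n with
  | zero => simp
  | succ n ih =>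
    rw [Finset.prod_range_succ, ih, ← zpow_add₀ hr]
    congr 1
    simp only [increment]
    ring

end Weights

/-! ### The upper bound -/

namespace IsJumpChain

variable {lam : ℤ × ℤ → ℝ} {Ω : Type*} [MeasurableSpace Ω] {P : Measure Ω}
  {Y : ℕ → Ω → ℕ × ℕ} {τ : ℕ → Ω → ℝ}

/-- Exponential Chebyshev inequality for chains that stay in a box. -/
lemma measure_le_of_box (hlam : ∀ y ∈ jumpSet, 0 < lam y) [IsProbabilityMeasure P]
    (hc : IsJumpChain lam P Y τ) (n : ℕ) {r M k : ℝ} (hr : 1 ≤ r) (hM : 0 ≤ M) (B : Set Ω)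
    (hbox : ∀ ω ∈ B, ∀ i ≤ n, ((Y i ω).1 : ℝ) ≤ M * r ^ 2 ∧ ((Y i ω).2 : ℝ) ≤ M * r ^ 2)
    (hB : ∀ ω ∈ B, k ≤ ∑ i ∈ Finset.range n, (totalRate lam (Y i ω) -
        2 * (lam (1, 0) + lam (0, 1) + costLip lam * M) * r) * τ i ω +
        stateCost lam (Y n ω) * τ n ω) :
    P B ≤ ENNReal.ofReal (Real.exp (-k)) *
      (ENNReal.ofReal (1 / 2) ^ n * ENNReal.ofReal ((lam (1, 0) + lam (0, 1) +
        costLip lam * (M * r ^ 2)) / (lam (1, 0) + lam (0, 1)))) := by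
  classical
  have l1 := hlam (1, 0) (by decide)
  have l2 := hlam (0, 1) (by decide)
  have hr0 : 0 < r := by linarith
  have ha : 0 < lam (1, 0) + lam (0, 1) := by positivity
  have hA : 0 < lam (1, 0) + lam (0, 1) + costLip lam * M := by
    have := (costLip_pos hlam).le
    positivity
  set a := lam (1, 0) + lam (0, 1) with hadef
  set A := a + costLip lam * M with hAdef
  let box : Set (ℕ × ℕ) := {z | (z.1 : ℝ) ≤ M * r ^ 2 ∧ (z.2 : ℝ) ≤ M * r ^ 2}
  -- The holding time in `Y n` also enters, so `n + 1` steps are used. There `θ` is the birth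
  -- intensity, which leaves exactly `stateCost` as the tilt.
  let θ : ℕ → ℝ := fun i => if i < n then 2 * A * r else a
  have hθ : ∀ i, 0 < θ i := fun i => by
    by_cases h : i < n
    · simp only [θ, if_pos h]; positivity
    · simpa only [θ, if_neg h] using ha
  let K : ℕ → ℕ × ℕ → ℕ × ℕ → ENNReal := fun i z w => box.indicator 1 z *
    if i < n then ENNReal.ofReal (jumpRate lam z (increment z w) / (2 * A * r) *
      r ^ ((increment z w).1 + (increment z w).2))
    else ENNReal.ofReal (jumpRate lam z (increment z w) / a)
  let R : ℕ → ENNReal := fun i => if i < n then ENNReal.ofReal (1 / 2) else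
    ENNReal.ofReal ((a + costLip lam * (M * r ^ 2)) / a)
  have hK : ∀ i z, ∑' w, K i z w ≤ R i := by
    intro i z
    simp only [K]
    rw [ENNReal.tsum_mul_left]
    by_cases hz : z ∈ box
    · rw [Set.indicator_of_mem hz, Pi.one_apply, one_mul]
      by_cases hi : i < n
      · simp only [R, if_pos hi]
        exact tsum_weighted_jumpRate_le hlam hr hM hz.1 hz.2
      · simp only [R, if_neg hi]
        exact tsum_jumpRate_div_le hlam ha hz.1 hz.2
    · rw [Set.indicator_of_notMem hz, zero_mul]
      exact zero_le
  have hsum := tsum_path_prod_le (0, 0) K R hK (n + 1)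
  have hR : ∏ i ∈ Finset.range (n + 1), R i = ENNReal.ofReal (1 / 2) ^ n *
      ENNReal.ofReal ((a + costLip lam * (M * r ^ 2)) / a) := by
    rw [Finset.prod_range_succ]
    congr 1
    · rw [Finset.prod_congr rfl (g := fun _ => ENNReal.ofReal (1 / 2)), Finset.prod_const,
        Finset.card_range]
      intro i hi
      simp only [R, if_pos (Finset.mem_range.1 hi)]
    · simp [R]
  rw [← hR]
  refine le_trans ?_ (mul_le_mul_right hsum _)
  rw [← ENNReal.tsum_mul_left]
  -- With the start built in, every path class that meets the event begins at the origin and stays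
  -- in the box.
  let B' := B ∩ {ω | Y 0 ω = (0, 0)}
  have hBB' : P B ≤ P B' := by
    refine measure_mono_ae ?_
    filter_upwards [hc.ae_start hlam] with ω hω hB using ⟨hB, hω⟩
  have hcover : B' ⊆ ⋃ z : Fin (n + 1 + 1) → ℕ × ℕ,
      (B' ∩ {ω | ∀ i ≤ n + 1, Y i ω = tupleSeq z i}) := by
    intro ω hω
    obtain ⟨z, hz⟩ := exists_tupleSeq_eq (n + 1) fun i => Y i ω
    exact Set.mem_iUnion.2 ⟨z, hω, fun i hi => (hz i hi).symm⟩
  refine hBB'.trans ((measure_mono hcover).trans ((measure_iUnion_le _).trans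
    (ENNReal.tsum_le_tsum fun z' => ?_)))
  set z := tupleSeq z'
  rcases Set.eq_empty_or_nonempty (B' ∩ {ω | ∀ i ≤ n + 1, Y i ω = z i}) with hemp | ⟨ω₀, hω₀⟩
  · rw [hemp, measure_empty]
    exact zero_le
  have hz0 : z 0 = (0, 0) := by
    rw [← hω₀.2 0 (Nat.zero_le _)]
    exact hω₀.1.2
  have hzbox : ∀ i ≤ n, z i ∈ box := by
    intro i hi
    rw [← hω₀.2 i (by omega)]
    exact hbox ω₀ hω₀.1.1 i hi
  have hmain := hc.measure_inter_path_le hlam z hz0 (n + 1) θ hθ k B' (by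
    intro ω hω hpath
    refine (hB ω hω.1).trans (le_of_eq ?_)
    rw [Finset.sum_range_succ]
    congr 1
    · refine Finset.sum_congr rfl fun i hi => ?_
      have hi' := Finset.mem_range.1 hi
      rw [hpath i (by omega)]
      simp only [θ, if_pos hi']
    · rw [hpath n (by omega), totalRate_eq]
      simp [θ, hadef])
  refine hmain.trans (mul_le_mul_right ?_ _)
  rw [hz0, Set.indicator_of_mem (Set.mem_singleton _), Pi.one_apply, one_mul,
    Finset.prod_range_succ, Finset.prod_range_succ]
  have hlast : K n (z n) (z (n + 1)) =
      ENNReal.ofReal (jumpRate lam (z n) (increment (z n) (z (n + 1))) / θ n) := by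
    simp [K, θ, hzbox n le_rfl]
  rw [hlast]
  refine mul_le_mul_left ?_ _
  have hrest : ∀ i ∈ Finset.range n, K i (z i) (z (i + 1)) =
      ENNReal.ofReal (jumpRate lam (z i) (increment (z i) (z (i + 1))) / θ i) *
        ENNReal.ofReal (r ^ ((increment (z i) (z (i + 1))).1 +
          (increment (z i) (z (i + 1))).2)) := by
    intro i hi
    have hi' := Finset.mem_range.1 hi
    simp only [K, θ, if_pos hi', Set.indicator_of_mem (hzbox i hi'.le), Pi.one_apply, one_mul]
    exact ENNReal.ofReal_mul (div_nonneg (jumpRate_nonneg hlam _ _) (by positivity))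
  rw [Finset.prod_congr rfl hrest, Finset.prod_mul_distrib,
    ← ENNReal.ofReal_prod_of_nonneg (f := fun i => r ^ ((increment (z i) (z (i + 1))).1 +
      (increment (z i) (z (i + 1))).2)) fun i _ => (zpow_pos hr0 _).le,
    prod_zpow_increment r hr0.ne' z n]
  -- The weights multiply to `r` to the power of the final coordinate sum, which is at least 1:
  -- inserting them was harmless.
  refine le_mul_of_one_le_right zero_le ?_
  rw [hz0]
  refine ENNReal.one_le_ofReal.2 (one_le_zpow₀ hr ?_)
  simp only [Nat.cast_zero]
  omega

end IsJumpChain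

section

variable {lam : ℤ × ℤ → ℝ} {Ω : Type*} [MeasurableSpace Ω] {P : Measure Ω}

/-- The event is split by the number of jumps up to `T = r ^ 2`. On each part the cost identity for
step paths supplies the Chebyshev threshold, and the bounds form a geometric series. -/
lemma IsJumpChain.measure_uniformNhd_le (hlam : ∀ y ∈ jumpSet, 0 < lam y) [IsProbabilityMeasure P]
    {Y : ℕ → Ω → ℕ × ℕ} {τ : ℕ → Ω → ℝ} (hc : IsJumpChain lam P Y τ) {ξ : ℝ → Ω → ℕ × ℕ}
    (hξ : ∀ᵐ ω ∂P, IsStepPath (fun n => Y n ω) (fun n => τ n ω) (fun t => ξ t ω))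
    {f : unitInterval → EuclideanSpace ℝ (Fin 2)} {ε M : ℝ} (hM : 0 ≤ M)
    (hbound : ∀ x ∈ uniformNhd f ε, ∀ t, ‖x t‖ ≤ M) {r : ℝ} (hr : 1 ≤ r) :
    P {ω | scaledPath ξ (r ^ 2) ω ∈ uniformNhd f ε} ≤
      ENNReal.ofReal (Real.exp (-((r ^ 2) ^ 2 * infRate lam f ε -
        2 * (lam (1, 0) + lam (0, 1) + costLip lam * M) * r * r ^ 2))) *
      (2 * ENNReal.ofReal ((lam (1, 0) + lam (0, 1) +
        costLip lam * (M * r ^ 2)) / (lam (1, 0) + lam (0, 1)))) := by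
  have l1 := hlam (1, 0) (by decide)
  have l2 := hlam (0, 1) (by decide)
  have hC := costLip_pos hlam
  set a := lam (1, 0) + lam (0, 1) with hadef
  set θ := 2 * (a + costLip lam * M) * r with hθ
  set H := ENNReal.ofReal ((a + costLip lam * (M * r ^ 2)) / a)
  set T := r ^ 2 with hTdef
  have hT : 0 < T := by positivity
  have hθ0 : 0 ≤ θ := by positivity
  let G : Set Ω := {ω | (∀ n, 0 < τ n ω) ∧
    IsStepPath (fun n => Y n ω) (fun n => τ n ω) (fun t => ξ t ω) ∧
      scaledPath ξ T ω ∈ uniformNhd f ε}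
  have hbox : ∀ ω ∈ G, ∀ i, ∑ j ∈ Finset.range i, τ j ω ≤ T →
      ((Y i ω).1 : ℝ) ≤ M * T ∧ ((Y i ω).2 : ℝ) ≤ M * T := by
    rintro ω ⟨hpos, hstep, hmem⟩ i hi
    have h0 : 0 ≤ ∑ j ∈ Finset.range i, τ j ω := Finset.sum_nonneg fun j _ => (hpos j).le
    let t : unitInterval := ⟨(∑ j ∈ Finset.range i, τ j ω) / T, div_nonneg h0 hT.le,
      (div_le_one hT).2 hi⟩
    have ht : (t : ℝ) * T = ∑ j ∈ Finset.range i, τ j ω := div_mul_cancel₀ _ hT.ne'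
    have hval : ξ ((t : ℝ) * T) ω = Y i ω := by
      rw [ht]
      refine hstep i _ le_rfl ?_
      rw [Finset.sum_range_succ]
      linarith [hpos i]
    have hn := hbound _ hmem t
    have h1 := (abs_apply_sub_le (scaledPath ξ T ω t) 0 0)
    have h2 := (abs_apply_sub_le (scaledPath ξ T ω t) 0 1)
    rw [sub_zero] at h1 h2
    have h1' := (le_abs_self _).trans (h1.trans hn)
    have h2' := (le_abs_self _).trans (h2.trans hn)
    simp only [scaledPath, hval, PiLp.zero_apply, sub_zero] at h1' h2'
    exact ⟨(div_le_iff₀ hT).1 (by simpa using h1'), (div_le_iff₀ hT).1 (by simpa using h2')⟩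
  have hmono : ∀ ω ∈ G, Monotone fun n => ∑ j ∈ Finset.range n, τ j ω := fun ω hω =>
    monotone_nat_of_le_succ fun n => by
      rw [Finset.sum_range_succ]
      linarith [hω.1 n]
  let B : ℕ → Set Ω := fun n => {ω ∈ G | ∑ j ∈ Finset.range n, τ j ω ≤ T ∧
    T < ∑ j ∈ Finset.range (n + 1), τ j ω}
  -- Infinitely many jumps up to time `T`.
  let E : Set Ω := {ω ∈ G | ∀ n, ∑ j ∈ Finset.range n, τ j ω ≤ T}
  have hBn : ∀ n, P (B n) ≤ ENNReal.ofReal (Real.exp (-(T ^ 2 * infRate lam f ε - θ * T))) *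
      (ENNReal.ofReal (1 / 2) ^ n * H) := by
    intro n
    refine hc.measure_le_of_box hlam n hr hM (B n) ?_ ?_
    · exact fun ω hω i hi => hbox ω hω.1 i ((hmono ω hω.1 hi).trans hω.2.1)
    · intro ω hω
      obtain ⟨hG, h1, h2⟩ := hω
      have hrate := rateFunction_rescaledPath lam hG.2.1 (fun i => (hG.1 i).le) hT h1 h2.le
      have hJ := infRate_le hlam hG.2.2
      rw [scaledPath_eq_rescaledPath] at hJ
      have hJ' := mul_le_mul_of_nonneg_left hJ (sq_nonneg T)
      rw [hrate] at hJ'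
      -- The last holding time runs past `T`, so it dominates the piece cut off at `T`.
      have e1 : stateCost lam (Y n ω) * (T - ∑ i ∈ Finset.range n, τ i ω) ≤
          stateCost lam (Y n ω) * τ n ω := by
        refine mul_le_mul_of_nonneg_left ?_ (stateCost_nonneg hlam _)
        rw [Finset.sum_range_succ] at h2
        linarith
      have e2 : ∑ i ∈ Finset.range n, stateCost lam (Y i ω) * τ i ω -
          θ * ∑ i ∈ Finset.range n, τ i ω ≤
          ∑ i ∈ Finset.range n, (totalRate lam (Y i ω) - θ) * τ i ω := by
        rw [Finset.mul_sum, ← Finset.sum_sub_distrib]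
        refine Finset.sum_le_sum fun i _ => ?_
        rw [totalRate_eq, ← hadef, ← sub_mul]
        exact mul_le_mul_of_nonneg_right (by linarith) (hG.1 i).le
      have e3 := mul_le_mul_of_nonneg_left h1 hθ0
      linarith
  -- On this event the box bound holds for every `n` with the same threshold `-(θ * T)`; let `n`
  -- tend to infinity.
  have hE : P E = 0 := by
    have hn : ∀ n : ℕ, P E ≤ ENNReal.ofReal (Real.exp (-(-(θ * T)))) *
        (ENNReal.ofReal (1 / 2) ^ n * H) := by
      intro n
      refine hc.measure_le_of_box hlam n hr hM E (fun ω hω i _ => hbox ω hω.1 i (hω.2 i)) ?_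
      intro ω hω
      obtain ⟨hG, hle⟩ := hω
      have e2 : -(θ * ∑ i ∈ Finset.range n, τ i ω) ≤
          ∑ i ∈ Finset.range n, (totalRate lam (Y i ω) - θ) * τ i ω := by
        rw [Finset.mul_sum, ← Finset.sum_neg_distrib]
        refine Finset.sum_le_sum fun i _ => ?_
        rw [← neg_mul]
        exact mul_le_mul_of_nonneg_right (by linarith [totalRate_pos hlam (Y i ω)]) (hG.1 i).le
      have e3 := mul_le_mul_of_nonneg_left (hle n) hθ0
      have e4 := mul_nonneg (stateCost_nonneg hlam (Y n ω)) (hG.1 n).le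
      linarith
    refine le_antisymm ?_ zero_le
    have hlim : Tendsto (fun n : ℕ => ENNReal.ofReal (Real.exp (-(-(θ * T)))) *
        (ENNReal.ofReal (1 / 2) ^ n * H)) atTop (𝓝 (ENNReal.ofReal (Real.exp (-(-(θ * T)))) *
          (0 * H))) := by
      refine ENNReal.Tendsto.const_mul (ENNReal.Tendsto.mul_const
        (ENNReal.tendsto_pow_atTop_nhds_zero_of_lt_one ?_) (Or.inr ENNReal.ofReal_ne_top))
        (Or.inr ENNReal.ofReal_ne_top)
      rw [ENNReal.ofReal_lt_one]
      norm_num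
    simpa using ge_of_tendsto' hlim hn
  have hcover : ∀ᵐ ω ∂P, ω ∈ {ω | scaledPath ξ T ω ∈ uniformNhd f ε} → ω ∈ (⋃ n, B n) ∪ E := by
    filter_upwards [hc.ae_holding_pos hlam, hξ] with ω h1 h2 h3
    have hG : ω ∈ G := ⟨h1, h2, h3⟩
    by_cases hexp : ∀ n, ∑ j ∈ Finset.range n, τ j ω ≤ T
    · exact Or.inr ⟨hG, hexp⟩
    · push Not at hexp
      obtain ⟨N, hN⟩ := hexp
      obtain ⟨k, -, hk⟩ := exists_partial_sum_le_lt hT.le hN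
      exact Or.inl (Set.mem_iUnion.2 ⟨k, hG, hk⟩)
  calc P {ω | scaledPath ξ T ω ∈ uniformNhd f ε} ≤ P ((⋃ n, B n) ∪ E) := measure_mono_ae hcover
    _ ≤ P (⋃ n, B n) + P E := measure_union_le _ _
    _ ≤ ∑' n, P (B n) := by rw [hE, add_zero]; exact measure_iUnion_le _
    _ ≤ ∑' n, ENNReal.ofReal (Real.exp (-(T ^ 2 * infRate lam f ε - θ * T))) *
      (ENNReal.ofReal (1 / 2) ^ n * H) := ENNReal.tsum_le_tsum hBn
    _ = _ := by
      rw [ENNReal.tsum_mul_left, ENNReal.tsum_mul_right, ENNReal.tsum_geometric,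
        show ENNReal.ofReal (1 / 2) = 2⁻¹ by
          rw [one_div, ENNReal.ofReal_inv_of_pos two_pos]; simp,
        ENNReal.one_sub_inv_two, inv_inv]

/-- With `r = √T` the correction in the exponent is of order `T ^ (3/2)` and the prefactor is linear
in `T`; each is absorbed by half of `δ * T ^ 2`. -/
lemma eventually_measure_uniformNhd_le (hlam : ∀ y ∈ jumpSet, 0 < lam y) [IsProbabilityMeasure P]
    {ξ : ℝ → Ω → ℕ × ℕ} (hξ : IsJumpProcess lam P ξ)
    {f : unitInterval → EuclideanSpace ℝ (Fin 2)} (hf : f ∈ excursionSet) (ε : ℝ) {δ : ℝ}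
    (hδ : 0 < δ) :
    ∀ᶠ T : ℝ in atTop, P.real {ω | scaledPath ξ T ω ∈ uniformNhd f ε} ≤
      Real.exp (-(T ^ 2 * (infRate lam f ε - δ))) := by
  obtain ⟨Y, τ, hc, hstep⟩ := hξ
  obtain ⟨M, hM, hbound⟩ := exists_norm_le_of_mem_uniformNhd hf ε
  have l1 := hlam (1, 0) (by decide)
  have l2 := hlam (0, 1) (by decide)
  have hC := costLip_pos hlam
  set a := lam (1, 0) + lam (0, 1) with hadef
  have ha : 0 < a := by positivity
  let D := 2 * ((a + costLip lam * M) / a)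
  have hD : 0 < D := by positivity
  filter_upwards [eventually_ge_atTop 1,
    Real.tendsto_sqrt_atTop.eventually_ge_atTop (4 * (a + costLip lam * M) / δ),
    eventually_ge_atTop (2 / δ * (|Real.log D| + 1))] with T hT1 hT2 hT3
  have hT0 : 0 < T := by linarith
  set r := √T with hr
  have hr2 : r ^ 2 = T := Real.sq_sqrt hT0.le
  have hr1 : 1 ≤ r := Real.one_le_sqrt.2 hT1
  have hr0 : 0 < r := by linarith
  have h := hc.measure_uniformNhd_le hlam hstep hM.le hbound hr1
  rw [hr2, ← hadef, show (2 : ENNReal) = ENNReal.ofReal 2 by simp,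
    ← ENNReal.ofReal_mul two_pos.le, ← ENNReal.ofReal_mul (Real.exp_pos _).le] at h
  refine (ENNReal.toReal_le_of_le_ofReal (by positivity) h).trans ?_
  have e1 : 2 * ((a + costLip lam * (M * T)) / a) ≤ D * T := by
    simp only [D]
    rw [mul_assoc, div_mul_eq_mul_div]
    gcongr
    nlinarith
  have e2 : D * T ≤ Real.exp (|Real.log D| + T) := by
    rw [Real.exp_add]
    refine mul_le_mul ?_ ((by linarith : T ≤ T + 1).trans (Real.add_one_le_exp T)) hT0.le
      (Real.exp_pos _).le
    exact (Real.log_le_iff_le_exp hD).1 (le_abs_self _)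
  refine (mul_le_mul_of_nonneg_left (e1.trans e2) (Real.exp_pos _).le).trans ?_
  rw [← Real.exp_add, Real.exp_le_exp]
  rw [div_le_iff₀ hδ] at hT2
  have e3 : 2 * (a + costLip lam * M) * r * T ≤ δ / 2 * T ^ 2 := by
    have : T ^ 2 = r * r * T := by rw [← hr2]; ring
    rw [this]
    have := mul_le_mul_of_nonneg_right hT2 (by positivity : 0 ≤ r * T / 2)
    nlinarith
  have e4 : |Real.log D| + T ≤ δ / 2 * T ^ 2 := by
    have h1 : |Real.log D| + T ≤ (|Real.log D| + 1) * T := by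
      nlinarith [abs_nonneg (Real.log D)]
    have h2 : (|Real.log D| + 1) ≤ δ / 2 * T := by
      rw [div_mul_eq_mul_div, div_le_iff₀ hδ] at hT3
      linarith
    nlinarith
  linarith
end

/-! ### Smoothing by backward averages -/

/-- The average of a path on an interval of length `σ` ending at `t`. -/
def backwardAverage {E : Type*} [NormedAddCommGroup E] [NormedSpace ℝ E] (x : ℝ → E) (σ t : ℝ) : E :=
  σ⁻¹ • ∫ s in (t - σ)..t, x s

section BackwardAverage

variable {E : Type*} [NormedAddCommGroup E] [NormedSpace ℝ E]
  {x : ℝ → E} {M σ : ℝ}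

lemma norm_backwardAverage_sub_le [CompleteSpace E] (hx : ∀ a b, IntervalIntegrable x volume a b)
    (hσ : 0 < σ) {t C : ℝ} {v : E} (h : ∀ s, |s - t| ≤ σ → ‖x s - v‖ ≤ C) :
    ‖backwardAverage x σ t - v‖ ≤ C := by
  have e : backwardAverage x σ t - v = σ⁻¹ • ∫ s in (t - σ)..t, (x s - v) := by
    rw [intervalIntegral.integral_sub (hx _ _) intervalIntegrable_const,
      intervalIntegral.integral_const, smul_sub, backwardAverage, sub_sub_cancel, smul_smul,
      inv_mul_cancel₀ hσ.ne', one_smul]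
  have hb : ‖∫ s in (t - σ)..t, (x s - v)‖ ≤ C * |t - (t - σ)| := by
    refine intervalIntegral.norm_integral_le_of_norm_le_const fun s hs => h s ?_
    rw [Set.uIoc_of_le (by linarith)] at hs
    rw [abs_le]
    constructor <;> linarith [hs.1, hs.2]
  rw [e, norm_smul, norm_inv, Real.norm_eq_abs, abs_of_pos hσ]
  rw [sub_sub_cancel, abs_of_pos hσ] at hb
  calc σ⁻¹ * ‖∫ s in (t - σ)..t, (x s - v)‖ ≤ σ⁻¹ * (C * σ) := by gcongr
    _ = C := by field_simp

lemma norm_backwardAverage_le [CompleteSpace E] (hx : ∀ a b, IntervalIntegrable x volume a b)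
    (hσ : 0 < σ) (hM : ∀ s, ‖x s‖ ≤ M) (t : ℝ) : ‖backwardAverage x σ t‖ ≤ M := by
  simpa using norm_backwardAverage_sub_le hx hσ (t := t) (v := 0) fun s _ => by simpa using hM s

/-- The two integrals differ by integrals over two intervals of length `|s - t|`. -/
lemma norm_backwardAverage_sub_backwardAverage_le (hx : ∀ a b, IntervalIntegrable x volume a b)
    (hσ : 0 < σ) (hM : ∀ s, ‖x s‖ ≤ M) (s t : ℝ) :
    ‖backwardAverage x σ s - backwardAverage x σ t‖ ≤ 2 * M / σ * |s - t| := by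
  have e : (∫ u in (s - σ)..s, x u) - ∫ u in (t - σ)..t, x u =
      (∫ u in t..s, x u) - ∫ u in (t - σ)..(s - σ), x u := by
    rw [← intervalIntegral.integral_interval_sub_left (hx 0 s) (hx 0 (s - σ)),
      ← intervalIntegral.integral_interval_sub_left (hx 0 t) (hx 0 (t - σ)),
      ← intervalIntegral.integral_interval_sub_left (hx 0 s) (hx 0 t),
      ← intervalIntegral.integral_interval_sub_left (hx 0 (s - σ)) (hx 0 (t - σ))]
    abel
  have h1 : ‖∫ u in t..s, x u‖ ≤ M * |s - t| :=
    intervalIntegral.norm_integral_le_of_norm_le_const fun u _ => hM u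
  have h2 : ‖∫ u in (t - σ)..(s - σ), x u‖ ≤ M * |s - σ - (t - σ)| :=
    intervalIntegral.norm_integral_le_of_norm_le_const fun u _ => hM u
  rw [sub_sub_sub_cancel_right] at h2
  rw [backwardAverage, backwardAverage, ← smul_sub, e, norm_smul, norm_inv, Real.norm_eq_abs,
    abs_of_pos hσ, inv_mul_le_iff₀ hσ]
  refine (norm_sub_le _ _).trans (le_of_le_of_eq (add_le_add h1 h2) ?_)
  field_simp
  ring

/-- This is the differentiability of the integral at a point of continuity. -/
lemma tendsto_backwardAverage [CompleteSpace E] (hx : ∀ a b, IntervalIntegrable x volume a b)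
    (hmeas : StronglyMeasurable x) {t : ℝ} (ht : ContinuousAt x t) {u : ℕ → ℝ}
    (hu : Tendsto u atTop (𝓝 0)) (hpos : ∀ n, 0 < u n) :
    Tendsto (fun n => backwardAverage x (u n) t) atTop (𝓝 (x t)) := by
  have hd := intervalIntegral.integral_hasDerivAt_right (hx 0 t)
    (hmeas.stronglyMeasurableAtFilter) ht
  have hs := hd.tendsto_slope_zero
  have hu' : Tendsto (fun n => -u n) atTop (𝓝[≠] 0) := by
    refine tendsto_nhdsWithin_iff.2 ⟨by simpa using hu.neg, Eventually.of_forall fun n => ?_⟩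
    simpa using (hpos n).ne'
  refine (hs.comp hu').congr fun n => ?_
  simp only [Function.comp, backwardAverage]
  rw [intervalIntegral.integral_interval_sub_left (hx _ _) (hx _ _), ← sub_eq_add_neg,
    intervalIntegral.integral_symm, inv_neg, smul_neg, neg_smul, neg_neg]

end BackwardAverage

lemma backwardAverage_nonneg {x : ℝ → EuclideanSpace ℝ (Fin 2)} {σ : ℝ} (hσ : 0 < σ)
    (hx : ∀ a b, IntervalIntegrable x volume a b) (h : ∀ s i, 0 ≤ x s i) (t : ℝ) (i : Fin 2) :
    0 ≤ backwardAverage x σ t i := by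
  have e := (EuclideanSpace.proj i :
    EuclideanSpace ℝ (Fin 2) →L[ℝ] ℝ).intervalIntegral_comp_comm (hx (t - σ) t)
  have h0 : 0 ≤ ∫ s in (t - σ)..t, x s i :=
    intervalIntegral.integral_nonneg (by linarith) fun s _ => h s i
  rw [backwardAverage, PiLp.smul_apply, smul_eq_mul]
  refine mul_nonneg (inv_nonneg.2 hσ.le) ?_
  exact h0.trans_eq e

/-- A path in a neighbourhood can be replaced by a Lipschitz one at almost the same cost. -/
lemma exists_lipschitz_of_mem_uniformNhd {lam : ℤ × ℤ → ℝ} (hlam : ∀ y ∈ jumpSet, 0 < lam y)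
    {f x : unitInterval → EuclideanSpace ℝ (Fin 2)} (hf : f ∈ excursionSet) {ε δ : ℝ}
    (hx : x ∈ uniformNhd f ε) (hδ : 0 < δ) :
    ∃ (g : ℝ → EuclideanSpace ℝ (Fin 2)) (K ε' : ℝ), 0 < K ∧ ε' < ε ∧ g 0 = 0 ∧
      (∀ t i, 0 ≤ g t i) ∧ (∀ s t, ‖g s - g t‖ ≤ K * |s - t|) ∧
      (∀ t : unitInterval, ‖g t - f t‖ ≤ ε') ∧
      ∫ t in (0 : ℝ)..1, pointCost lam (g t) ≤ rateFunction lam x + δ := by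
  obtain ⟨M, hM, hMx⟩ := exists_norm_le_of_mem_uniformNhd hf ε
  obtain ⟨ε₀, hε₀, hd⟩ := exists_dist_le_of_mem_uniformNhd hx
  have hmx := measurable_of_mem_pathSpace hx.1
  let p : ℝ → unitInterval := Set.projIcc 0 1 zero_le_one
  have hp : LipschitzWith 1 p := LipschitzWith.projIcc _
  let X : ℝ → EuclideanSpace ℝ (Fin 2) := fun s => x (p s)
  have hX : Measurable X := hmx.comp hp.continuous.measurable
  have hXb : ∀ s, ‖X s‖ ≤ M := fun s => hMx x hx (p s)
  have hXi : ∀ a b, IntervalIntegrable X volume a b := fun a b =>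
    (intervalIntegrable_const (c := M)).mono_fun hX.aestronglyMeasurable
      (Eventually.of_forall fun s => by simpa [abs_of_pos hM] using hXb s)
  -- The path is extended constantly, hence by zero to negative times. Averaging over the past thus
  -- keeps the starting value zero.
  have hXneg : ∀ s ≤ 0, X s = 0 := fun s hs => by
    simp only [X, p, Set.projIcc_of_le_left _ hs]
    exact hx.1.1
  have hfu : UniformContinuous fun s => f (p s) :=
    (CompactSpace.uniformContinuous_of_continuous hf.2.1).comp hp.uniformContinuous
  -- Averaging displaces the path relative to `f` by at most the oscillation of `f`, for which half
  -- of the free room is spent.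
  obtain ⟨σ₀, hσ₀, hσf⟩ := Metric.uniformContinuous_iff.1 hfu ((ε - ε₀) / 2) (by linarith)
  let u : ℕ → ℝ := fun n => 1 / ((n : ℝ) + 1)
  have hu0 : ∀ n, 0 < u n := fun n => by simp only [u]; positivity
  have hu : Tendsto u atTop (𝓝 0) := tendsto_one_div_add_atTop_nhds_zero_nat
  have hLip : ∀ n s t, ‖backwardAverage X (u n) s - backwardAverage X (u n) t‖ ≤
      2 * M / u n * |s - t| := fun n s t =>
    norm_backwardAverage_sub_backwardAverage_le hXi (hu0 n) hXb s t
  have hcont : ∀ n, Continuous (backwardAverage X (u n)) := fun n => by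
    refine (LipschitzWith.of_dist_le_mul (K := (2 * M / u n).toNNReal) fun s t => ?_).continuous
    have : 0 ≤ 2 * M / u n := div_nonneg (by positivity) (hu0 n).le
    rw [dist_eq_norm, Real.dist_eq, Real.coe_toNNReal _ this]
    exact hLip n s t
  have hp_coe : ∀ t : unitInterval, p t = t := fun t => Set.projIcc_val zero_le_one t
  have hlim : Tendsto (fun n => ∫ t : unitInterval, pointCost lam (backwardAverage X (u n) t)) atTop
      (𝓝 (rateFunction lam x)) := by
    rw [rateFunction_eq]
    refine tendsto_integral_of_dominated_convergence (fun _ => costLip lam * M) (fun n => ?_)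
      (integrable_const _) (fun n => Eventually.of_forall fun t => ?_) ?_
    · exact ((continuous_pointCost lam).comp
        ((hcont n).comp continuous_subtype_val)).aestronglyMeasurable
    · exact (abs_pointCost_le hlam _).trans (mul_le_mul_of_nonneg_left
        (norm_backwardAverage_le hXi (hu0 n) hXb _) (costLip_pos hlam).le)
    · filter_upwards [measure_eq_zero_iff_ae_notMem.1
        (hx.1.2.2.2.2.measure_zero (volume : Measure unitInterval))] with t ht
      have ht' : ContinuousAt x t := not_not.1 ht
      have hXt : ContinuousAt X t :=
        ContinuousAt.comp (by rwa [hp_coe]) hp.continuous.continuousAt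
      have := tendsto_backwardAverage hXi hX.stronglyMeasurable hXt hu hu0
      simp only [X, hp_coe] at this
      exact ((continuous_pointCost lam).tendsto _).comp this
  obtain ⟨n, hn1, hn2⟩ := ((hlim.eventually (gt_mem_nhds (show rateFunction lam x <
    rateFunction lam x + δ by linarith))).and (hu.eventually (gt_mem_nhds hσ₀))).exists
  refine ⟨backwardAverage X (u n), 2 * M / u n, (ε + ε₀) / 2, div_pos (by positivity) (hu0 n),
    by linarith, ?_, fun t i => backwardAverage_nonneg (hu0 n) hXi (fun s i => hx.1.2.1 _ i) t i,
    hLip n, fun t => ?_, ?_⟩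
  · rw [backwardAverage, intervalIntegral.integral_congr (g := fun _ => 0),
      intervalIntegral.integral_zero, smul_zero]
    intro s hs
    rw [Set.uIcc_of_le (by linarith [hu0 n])] at hs
    exact hXneg s hs.2
  · have h := norm_backwardAverage_sub_le hXi (hu0 n) (t := t) (v := f (p t)) (C := (ε + ε₀) / 2)
      fun s hs => by
        have h1 := hd (p s)
        have h2 := hσf (show dist s t < σ₀ by rw [Real.dist_eq]; linarith)
        rw [dist_eq_norm] at h2
        calc ‖X s - f (p t)‖ = ‖(x (p s) - f (p s)) + (f (p s) - f (p t))‖ := by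
              simp only [X]; congr 1; abel
          _ ≤ ε₀ + (ε - ε₀) / 2 := (norm_add_le _ _).trans (add_le_add h1 h2.le)
          _ = (ε + ε₀) / 2 := by ring
    rwa [hp_coe] at h
  · rw [intervalIntegral.integral_of_le zero_le_one, ← integral_Icc_eq_integral_Ioc,
      ← integral_subtype measurableSet_Icc]
    exact hn1.le

/-! ### Lattice paths tracking a curve -/

/-- A unit step towards `u`, upwards when already there. -/
def greedyStep (a : ℕ) (u : ℝ) : ℕ := if (a : ℝ) ≤ u then a + 1 else a - 1

/-- A lattice path following two given sequences: at even times the first coordinate makes a step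
towards the first sequence, at odd times the second coordinate towards the second one. -/
def greedyPath (u v : ℕ → ℝ) : ℕ → ℕ × ℕ
  | 0 => (0, 0)
  | i + 1 => if Even i then (greedyStep (greedyPath u v i).1 (u i), (greedyPath u v i).2)
      else ((greedyPath u v i).1, greedyStep (greedyPath u v i).2 (v i))

/-- A step brings an error of at most 2 down to at most 1, and the target moves by at most 1/2. A
downward step starts above `u ≥ 0`, so the subtraction is not truncated. -/
lemma abs_greedyStep_sub_le {a : ℕ} {u u' : ℝ} (hu : 0 ≤ u) (h : |(a : ℝ) - u| ≤ 2)
    (hu' : |u' - u| ≤ 1 / 2) : |(greedyStep a u : ℝ) - u'| ≤ 3 / 2 := by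
  rw [abs_le] at h hu' ⊢
  unfold greedyStep
  split_ifs with hau
  · push_cast
    constructor <;> linarith [h.1, h.2, hu'.1, hu'.2]
  · have ha : 1 ≤ a := by
      by_contra h0
      have : a = 0 := by omega
      subst this
      simp at hau
      linarith
    push Not at hau
    rw [Nat.cast_sub ha, Nat.cast_one]
    constructor <;> linarith [h.1, h.2, hu'.1, hu'.2]

lemma abs_sub_le_of_abs_sub_le {a u u' : ℝ} (h : |a - u| ≤ 3 / 2) (hu' : |u' - u| ≤ 1 / 2) :
    |a - u'| ≤ 2 := by
  rw [abs_le] at *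
  constructor <;> linarith [h.1, h.2, hu'.1, hu'.2]

/-- The induction also records, by parity, that the coordinate moved last has error at most 3/2; it
then idles for one step and the error grows to at most 2. -/
lemma abs_greedyPath_sub_le {u v : ℕ → ℝ} (hu : ∀ i, 0 ≤ u i) (hv : ∀ i, 0 ≤ v i)
    (hu0 : u 0 = 0) (hv0 : v 0 = 0) (hu1 : ∀ i, |u (i + 1) - u i| ≤ 1 / 2)
    (hv1 : ∀ i, |v (i + 1) - v i| ≤ 1 / 2) (i : ℕ) :
    |((greedyPath u v i).1 : ℝ) - u i| ≤ 2 ∧ |((greedyPath u v i).2 : ℝ) - v i| ≤ 2 := by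
  suffices h : (|((greedyPath u v i).1 : ℝ) - u i| ≤ 2 ∧
      |((greedyPath u v i).2 : ℝ) - v i| ≤ 2) ∧
      (Even i → |((greedyPath u v i).2 : ℝ) - v i| ≤ 3 / 2) ∧
      (¬ Even i → |((greedyPath u v i).1 : ℝ) - u i| ≤ 3 / 2) from h.1
  induction i with
  | zero => norm_num [greedyPath, hu0, hv0]
  | succ i ih =>
    obtain ⟨⟨h1, h2⟩, h3, h4⟩ := ih
    by_cases hi : Even i
    · have e1 := abs_greedyStep_sub_le (hu i) h1 (hu1 i)
      have e2 := abs_sub_le_of_abs_sub_le (h3 hi) (hv1 i)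
      simp only [greedyPath, if_pos hi]
      exact ⟨⟨e1.trans (by norm_num), e2⟩,
        fun h => absurd hi (by rwa [Nat.even_add_one] at h), fun _ => e1⟩
    · have e1 := abs_greedyStep_sub_le (hv i) h2 (hv1 i)
      have e2 := abs_sub_le_of_abs_sub_le (h4 hi) (hu1 i)
      simp only [greedyPath, if_neg hi]
      exact ⟨⟨e2, e1.trans (by norm_num)⟩, fun _ => e1,
        fun h => absurd (Nat.even_add_one.2 hi) h⟩

/-- Only single births and deaths occur, and a death only from a coordinate that is at least 1. The
bound does not depend on the curve or on `T`. -/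
lemma exists_pos_le_jumpRate_greedyPath {lam : ℤ × ℤ → ℝ} (hlam : ∀ y ∈ jumpSet, 0 < lam y) :
    ∃ m > 0, ∀ u v : ℕ → ℝ, (∀ i, 0 ≤ u i) → (∀ i, 0 ≤ v i) → ∀ i,
      m ≤ jumpRate lam (greedyPath u v i)
        (increment (greedyPath u v i) (greedyPath u v (i + 1))) := by
  have l1 := hlam (1, 0) (by decide)
  have l2 := hlam (0, 1) (by decide)
  have l3 := hlam (-1, 0) (by decide)
  have l4 := hlam (0, -1) (by decide)
  refine ⟨min (min (lam (1, 0)) (lam (0, 1))) (min (lam (-1, 0)) (lam (0, -1))),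
    lt_min (lt_min l1 l2) (lt_min l3 l4), fun u v hu hv i => ?_⟩
  have hdown : ∀ (a : ℕ) (r : ℝ), 0 ≤ r → ¬ (a : ℝ) ≤ r → 1 ≤ a := by
    intro a r hr h
    by_contra h0
    have : a = 0 := by omega
    subst this
    simp at h
    linarith
  have hmul : ∀ (a : ℕ) (c : ℝ), 0 < c → 1 ≤ a → c ≤ (a : ℝ) * c := fun a c hc ha =>
    le_mul_of_one_le_left hc.le (by exact_mod_cast ha)
  set z := greedyPath u v i with hz
  by_cases hi : Even i
  · by_cases h : (z.1 : ℝ) ≤ u i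
    · have : increment z (greedyPath u v (i + 1)) = (1, 0) := by
        simp [increment, greedyPath, hi, greedyStep, ← hz, h]
      rw [this]
      simp [jumpRate]
    · have h1 := hdown _ _ (hu i) h
      have : increment z (greedyPath u v (i + 1)) = (-1, 0) := by
        simp [increment, greedyPath, hi, greedyStep, ← hz, h, Nat.cast_sub h1]
      rw [this]
      simp only [jumpRate]
      norm_num
      exact Or.inr (Or.inl (hmul _ _ l3 h1))
  · by_cases h : (z.2 : ℝ) ≤ v i
    · have : increment z (greedyPath u v (i + 1)) = (0, 1) := by
        simp [increment, greedyPath, hi, greedyStep, ← hz, h]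
      rw [this]
      simp [jumpRate]
    · have h1 := hdown _ _ (hv i) h
      have : increment z (greedyPath u v (i + 1)) = (0, -1) := by
        simp [increment, greedyPath, hi, greedyStep, ← hz, h, Nat.cast_sub h1]
      rw [this]
      simp only [jumpRate]
      norm_num
      exact Or.inr (Or.inr (hmul _ _ l4 h1))

lemma norm_le_abs_add_abs (v : EuclideanSpace ℝ (Fin 2)) : ‖v‖ ≤ |v 0| + |v 1| := by
  rw [EuclideanSpace.norm_eq, Fin.sum_univ_two]
  refine Real.sqrt_le_iff.2 ⟨by positivity, ?_⟩
  simp only [Real.norm_eq_abs]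
  nlinarith [abs_nonneg (v 0), abs_nonneg (v 1)]

/-- A left Riemann sum of a Lipschitz function, compared with the integral. -/
lemma riemann_sum_le {φ : ℝ → ℝ} {L h : ℝ} (hh : 0 ≤ h) (hL : 0 ≤ L)
    (hφ : ∀ s t, |φ s - φ t| ≤ L * |s - t|) (n : ℕ) :
    ∑ i ∈ Finset.range n, h * φ (i * h) ≤ (∫ t in (0 : ℝ)..(n * h), φ t) + n * (L * h ^ 2) := by
  have hcont : Continuous φ := by
    refine (LipschitzWith.of_dist_le_mul (K := L.toNNReal) fun s t => ?_).continuous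
    rw [Real.dist_eq, Real.dist_eq, Real.coe_toNNReal _ hL]
    exact hφ s t
  have hint : ∀ a b, IntervalIntegrable φ volume a b := fun a b => hcont.intervalIntegrable a b
  have hsum := intervalIntegral.sum_integral_adjacent_intervals (n := n)
    (a := fun k : ℕ => (k : ℝ) * h) (f := φ) (μ := volume) fun k _ => hint _ _
  simp only [Nat.cast_zero, zero_mul] at hsum
  rw [← hsum, ← nsmul_eq_mul n, ← Finset.card_range n, ← Finset.sum_const, Finset.card_range,
    ← Finset.sum_add_distrib]
  refine Finset.sum_le_sum fun i _ => ?_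
  have hle : (i : ℝ) * h ≤ ((i + 1 : ℕ) : ℝ) * h := by
    push_cast
    nlinarith
  have h1 : ∫ t in (i : ℝ) * h..((i + 1 : ℕ) : ℝ) * h, (φ (i * h) - L * h) ≤
      ∫ t in (i : ℝ) * h..((i + 1 : ℕ) : ℝ) * h, φ t := by
    refine intervalIntegral.integral_mono_on hle intervalIntegrable_const (hint _ _) fun t ht => ?_
    have h2 := (abs_le.1 (hφ (i * h) t)).2
    have h3 : |(i : ℝ) * h - t| ≤ h := by
      have := ht.2
      push_cast at this
      rw [abs_le]
      constructor <;> linarith [ht.1]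
    have := mul_le_mul_of_nonneg_left h3 hL
    linarith
  rw [intervalIntegral.integral_const, smul_eq_mul] at h1
  push_cast at h1 ⊢
  nlinarith

/-- A lattice path following `T • g`, where the `i`-th step corresponds to the time `i * h`. -/
def trackingPath (g : ℝ → EuclideanSpace ℝ (Fin 2)) (T h : ℝ) : ℕ → ℕ × ℕ :=
  greedyPath (fun i => T * g (i * h) 0) (fun i => T * g (i * h) 1)

section Tracking

variable {g : ℝ → EuclideanSpace ℝ (Fin 2)} {K T h : ℝ}

/-- By `hKh` the target `T • g` moves by at most 1/2 per step, so each coordinate is tracked with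
error at most 2 before rescaling. -/
lemma norm_trackingPath_sub_le (hT : 0 < T) (hh : 0 ≤ h) (hKh : T * (K * h) ≤ 1 / 2)
    (hg0 : g 0 = 0) (hg : ∀ t i, 0 ≤ g t i) (hK : ∀ s t, ‖g s - g t‖ ≤ K * |s - t|) (i : ℕ) :
    ‖!₂[((trackingPath g T h i).1 : ℝ) / T, ((trackingPath g T h i).2 : ℝ) / T] - g (i * h)‖ ≤
      4 / T := by
  have hstep : ∀ (j : Fin 2) (i : ℕ), |T * g ((i + 1 : ℕ) * h) j - T * g (i * h) j| ≤ 1 / 2 := by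
    intro j i
    rw [← mul_sub, abs_mul, abs_of_pos hT]
    refine (mul_le_mul_of_nonneg_left ((abs_apply_sub_le _ _ j).trans (hK _ _)) hT.le).trans ?_
    have : ((i + 1 : ℕ) : ℝ) * h - i * h = h := by push_cast; ring
    rwa [this, abs_of_nonneg hh]
  have hclose := abs_greedyPath_sub_le (u := fun i => T * g (i * h) 0)
    (v := fun i => T * g (i * h) 1) (fun i => mul_nonneg hT.le (hg _ _))
    (fun i => mul_nonneg hT.le (hg _ _)) (by simp [hg0]) (by simp [hg0]) (hstep 0) (hstep 1) i
  have hdiv : ∀ (a b : ℝ), |a - T * b| ≤ 2 → |a / T - b| ≤ 2 / T := by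
    intro a b hab
    have : a / T - b = (a - T * b) / T := by field_simp
    rw [this, abs_div, abs_of_pos hT]
    gcongr
  refine (norm_le_abs_add_abs _).trans ?_
  have e0 := hdiv _ _ hclose.1
  have e1 := hdiv _ _ hclose.2
  have : (4 : ℝ) / T = 2 / T + 2 / T := by ring
  rw [this]
  exact add_le_add e0 e1

lemma stateCost_trackingPath_le {lam : ℤ × ℤ → ℝ} (hlam : ∀ y ∈ jumpSet, 0 < lam y)
    (hT : 0 < T) (hh : 0 ≤ h) (hKh : T * (K * h) ≤ 1 / 2)
    (hg0 : g 0 = 0) (hg : ∀ t i, 0 ≤ g t i) (hK : ∀ s t, ‖g s - g t‖ ≤ K * |s - t|) (i : ℕ) :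
    stateCost lam (trackingPath g T h i) ≤ T * pointCost lam (g (i * h)) + 4 * costLip lam := by
  have h1 := norm_trackingPath_sub_le hT hh hKh hg0 hg hK i
  have h2 := (abs_le.1 (abs_pointCost_sub_le hlam
    !₂[((trackingPath g T h i).1 : ℝ) / T, ((trackingPath g T h i).2 : ℝ) / T] (g (i * h)))).2
  rw [pointCost_scaled lam _ hT] at h2
  have h3 := h2.trans (mul_le_mul_of_nonneg_left h1 (costLip_pos hlam).le)
  have h4 := mul_le_mul_of_nonneg_left h3 hT.le
  have e1 : T * (stateCost lam (trackingPath g T h i) / T - pointCost lam (g (i * h))) =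
      stateCost lam (trackingPath g T h i) - T * pointCost lam (g (i * h)) := by field_simp
  have e2 : T * (costLip lam * (4 / T)) = 4 * costLip lam := by field_simp
  rw [e1, e2] at h4
  linarith

/-- A step path along `trackingPath` with almost constant holding times is close to `g`. -/
lemma norm_rescaledPath_sub_le {s : ℕ → ℝ} {η : ℝ → ℕ × ℕ} {y : ℕ → ℕ × ℕ}
    (hη : IsStepPath y s η) {n : ℕ} (hy : ∀ i ≤ n, y i = trackingPath g T h i)
    (hT : 0 < T) (hh : 0 < h) (hK0 : 0 ≤ K) (hKh : T * (K * h) ≤ 1 / 2)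
    (hg0 : g 0 = 0) (hg : ∀ t i, 0 ≤ g t i) (hK : ∀ s t, ‖g s - g t‖ ≤ K * |s - t|)
    {κ : ℝ} (hκ : 0 ≤ κ) (hs : ∀ i < n, s i ∈ Set.Ioc (T * h) (T * h * (1 + κ)))
    (hn : T ≤ n * (T * h)) (t : unitInterval) :
    ‖rescaledPath η T t - g t‖ ≤ 4 / T + K * (κ + h * (1 + κ)) := by
  have hTh : 0 < T * h := by positivity
  have hlow : ∀ k ≤ n, (k : ℝ) * (T * h) ≤ ∑ i ∈ Finset.range k, s i := by
    intro k hk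
    rw [← nsmul_eq_mul, ← Finset.card_range k, ← Finset.sum_const, Finset.card_range]
    exact Finset.sum_le_sum fun i hi => (hs i (by rw [Finset.mem_range] at hi; omega)).1.le
  have hup : ∀ k ≤ n, ∑ i ∈ Finset.range k, s i ≤ k * (T * h * (1 + κ)) := by
    intro k hk
    rw [← nsmul_eq_mul, ← Finset.card_range k, ← Finset.sum_const, Finset.card_range]
    exact Finset.sum_le_sum fun i hi => (hs i (by rw [Finset.mem_range] at hi; omega)).2
  have hn0 : n ≠ 0 := by
    rintro rfl
    simp at hn
    linarith
  have hsn : T < ∑ i ∈ Finset.range n, s i := by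
    refine hn.trans_lt ?_
    rw [← nsmul_eq_mul, ← Finset.card_range n, ← Finset.sum_const, Finset.card_range]
    exact Finset.sum_lt_sum_of_nonempty (Finset.nonempty_range_iff.2 hn0)
      fun i hi => (hs i (Finset.mem_range.1 hi)).1
  have ht0 : 0 ≤ (t : ℝ) * T := mul_nonneg t.2.1 hT.le
  have ht1 : (t : ℝ) * T ≤ T := mul_le_of_le_one_left hT.le t.2.2
  obtain ⟨k, hk, h1, h2⟩ := exists_partial_sum_le_lt ht0 (ht1.trans_lt hsn)
  have hval : η ((t : ℝ) * T) = trackingPath g T h k := (hη k _ h1 h2).trans (hy k hk.le)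
  have h3 : (k : ℝ) * h ≤ t := by
    have := (hlow k hk.le).trans h1
    refine le_of_mul_le_mul_right ?_ hT
    linarith
  -- The clock error accumulated over `k` steps is at most `k * h * κ ≤ κ`; the current step adds `h
  -- * (1 + κ)`.
  have h4 : (t : ℝ) ≤ k * h + (κ + h * (1 + κ)) := by
    have h5 := h2.le.trans (hup (k + 1) hk)
    have h6 : (t : ℝ) ≤ (k + 1) * (h * (1 + κ)) := by
      refine le_of_mul_le_mul_right ?_ hT
      push_cast at h5
      linarith
    have h7 : (k : ℝ) * h * κ ≤ 1 * κ :=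
      mul_le_mul_of_nonneg_right (h3.trans t.2.2) hκ
    linarith
  have h5 := norm_trackingPath_sub_le hT hh.le hKh hg0 hg hK k
  have h6 : ‖g (k * h) - g t‖ ≤ K * (κ + h * (1 + κ)) := by
    refine (hK _ _).trans (mul_le_mul_of_nonneg_left ?_ hK0)
    rw [abs_le]
    constructor
    · linarith
    · have : 0 ≤ κ + h * (1 + κ) := by positivity
      linarith
  have e : rescaledPath η T t - g t = (!₂[((trackingPath g T h k).1 : ℝ) / T,
      ((trackingPath g T h k).2 : ℝ) / T] - g (k * h)) + (g (k * h) - g t) := by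
    simp only [rescaledPath, hval]
    abel
  rw [e]
  exact (norm_add_le _ _).trans (add_le_add h5 h6)

end Tracking

/-! ### The lower bound -/

section

variable {lam : ℤ × ℤ → ℝ} {Ω : Type*} [MeasurableSpace Ω] {P : Measure Ω}

/-- The probability of following a Lipschitz curve in the sense of `norm_rescaledPath_sub_le`. -/
lemma IsJumpChain.le_measureReal_uniformNhd (hlam : ∀ y ∈ jumpSet, 0 < lam y)
    [IsProbabilityMeasure P]
    {Y : ℕ → Ω → ℕ × ℕ} {τ : ℕ → Ω → ℝ} (hc : IsJumpChain lam P Y τ) {ξ : ℝ → Ω → ℕ × ℕ}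
    (hξ : ∀ᵐ ω ∂P, IsStepPath (fun n => Y n ω) (fun n => τ n ω) (fun t => ξ t ω))
    {f : unitInterval → EuclideanSpace ℝ (Fin 2)} {g : ℝ → EuclideanSpace ℝ (Fin 2)}
    {K ε ε' T h κ : ℝ} (hT : 0 < T) (hh : 0 < h) (hK0 : 0 ≤ K) (hKh : T * (K * h) ≤ 1 / 2)
    (hg0 : g 0 = 0) (hg : ∀ t i, 0 ≤ g t i) (hK : ∀ s t, ‖g s - g t‖ ≤ K * |s - t|)
    (hgf : ∀ t : unitInterval, ‖g t - f t‖ ≤ ε') (hκ : 0 ≤ κ)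
    (hε : 4 / T + K * (κ + h * (1 + κ)) + ε' < ε) {n : ℕ} (hn : T ≤ n * (T * h)) :
    ∏ i ∈ Finset.range n, (jumpProb lam (trackingPath g T h i)
        (increment (trackingPath g T h i) (trackingPath g T h (i + 1))) *
          (Real.exp (-(totalRate lam (trackingPath g T h i) * (T * h))) -
            Real.exp (-(totalRate lam (trackingPath g T h i) * (T * h * (1 + κ)))))) ≤
      P.real {ω | scaledPath ξ T ω ∈ uniformNhd f ε} := by
  have hTh : 0 ≤ T * h := by positivity
  have hbox := hc.measure_path_box hlam (trackingPath g T h) rfl n hTh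
    (le_mul_of_one_le_right hTh (by linarith) : T * h ≤ T * h * (1 + κ))
  rw [measureReal_def, ← ENNReal.ofReal_le_iff_le_toReal (measure_ne_top _ _), ← hbox]
  refine measure_mono_ae ?_
  filter_upwards [hc.ae_holding_pos hlam, hc.ae_start hlam, hξ] with ω hpos hstart hstep hA
  have hn0 : n ≠ 0 := by
    rintro rfl
    simp at hn
    linarith
  have hsn : T < ∑ i ∈ Finset.range n, τ i ω := by
    refine hn.trans_lt ?_
    rw [← nsmul_eq_mul, ← Finset.card_range n, ← Finset.sum_const, Finset.card_range]
    exact Finset.sum_lt_sum_of_nonempty (Finset.nonempty_range_iff.2 hn0)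
      fun i hi => (hA.1 i (Finset.mem_range.1 hi)).1
  refine mem_uniformNhd_of_dist_le (rescaledPath_mem_pathSpace hstep (hpos 0) hstart hT hsn) hε
    fun t => ?_
  have h1 := norm_rescaledPath_sub_le hstep hA.2 hT hh hK0 hKh hg0 hg hK hκ hA.1 hn t
  rw [← sub_add_sub_cancel _ (g t) (f t)]
  exact (norm_add_le _ _).trans (add_le_add h1 (hgf t))

/-- The total intensity is at least the birth intensity, so the probability of ending the holding
time within the extra `Δ * κ` is bounded below uniformly in the state. -/
lemma le_jumpProb_mul_exp_sub_exp (hlam : ∀ y ∈ jumpSet, 0 < lam y) {z : ℕ × ℕ} {y : ℤ × ℤ}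
    {m H Δ κ : ℝ} (hm : 0 < m) (hrate : m ≤ jumpRate lam z y) (hH : totalRate lam z ≤ H)
    (hΔ : 0 ≤ Δ) (hκ : 0 ≤ κ) :
    m / H * (1 - Real.exp (-((lam (1, 0) + lam (0, 1)) * (Δ * κ)))) *
        Real.exp (-(totalRate lam z * Δ)) ≤
      jumpProb lam z y * (Real.exp (-(totalRate lam z * Δ)) -
        Real.exp (-(totalRate lam z * (Δ * (1 + κ))))) := by
  have l1 := hlam (1, 0) (by decide)
  have l2 := hlam (0, 1) (by decide)
  have hpos := totalRate_pos hlam z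
  have h1 : Real.exp (-(totalRate lam z * (Δ * (1 + κ)))) ≤
      Real.exp (-(totalRate lam z * Δ)) * Real.exp (-((lam (1, 0) + lam (0, 1)) * (Δ * κ))) := by
    rw [← Real.exp_add, Real.exp_le_exp]
    have h2 : lam (1, 0) + lam (0, 1) ≤ totalRate lam z := by
      rw [totalRate_eq]
      linarith [stateCost_nonneg hlam z]
    have h3 := mul_le_mul_of_nonneg_right h2 (by positivity : 0 ≤ Δ * κ)
    linarith
  have h2 : m / H ≤ jumpProb lam z y :=
    div_le_div₀ (hm.le.trans hrate) hrate hpos hH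
  have h3 : 0 ≤ 1 - Real.exp (-((lam (1, 0) + lam (0, 1)) * (Δ * κ))) := by
    rw [sub_nonneg, Real.exp_le_one_iff, neg_nonpos]
    positivity
  rw [mul_assoc]
  refine mul_le_mul h2 (by linarith) (mul_nonneg h3 (Real.exp_pos _).le)
    (jumpProb_nonneg hlam z y)

/-- The total intensity accumulated along a tracking path. -/
lemma sum_totalRate_trackingPath_le (hlam : ∀ y ∈ jumpSet, 0 < lam y)
    {g : ℝ → EuclideanSpace ℝ (Fin 2)} {K T h : ℝ} (hT : 0 < T) (hh : 0 < h) (hK0 : 0 ≤ K)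
    (hKh : T * (K * h) ≤ 1 / 2) (hg0 : g 0 = 0) (hg : ∀ t i, 0 ≤ g t i)
    (hK : ∀ s t, ‖g s - g t‖ ≤ K * |s - t|) {n : ℕ} (hn1 : 1 ≤ n * h) (hn2 : n * h ≤ 1 + h)
    (hn3 : n * h ≤ 2) :
    ∑ i ∈ Finset.range n, totalRate lam (trackingPath g T h i) * (T * h) ≤
      T ^ 2 * (∫ t in (0 : ℝ)..1, pointCost lam (g t)) +
        (2 * (lam (1, 0) + lam (0, 1)) + 10 * costLip lam) * T := by
  have l1 := hlam (1, 0) (by decide)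
  have l2 := hlam (0, 1) (by decide)
  have hC := costLip_pos hlam
  set a := lam (1, 0) + lam (0, 1) with ha
  set C := costLip lam
  let φ : ℝ → ℝ := fun t => pointCost lam (g t)
  have hφ : ∀ s t, |φ s - φ t| ≤ C * K * |s - t| := fun s t =>
    (abs_pointCost_sub_le hlam _ _).trans
      ((mul_le_mul_of_nonneg_left (hK s t) hC.le).trans_eq (mul_assoc _ _ _).symm)
  have hφ0 : φ 0 = 0 := by simp [φ, hg0, pointCost]
  have hcont : Continuous φ := by
    refine (LipschitzWith.of_dist_le_mul (K := (C * K).toNNReal) fun s t => ?_).continuous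
    rw [Real.dist_eq, Real.dist_eq, Real.coe_toNNReal _ (by positivity)]
    exact hφ s t
  have hR := riemann_sum_le hh.le (by positivity) hφ n
  -- The grid overshoots 1 by at most `h`, and `φ ≤ 2 * C * K` up to time 2 since `φ 0 = 0`.
  have htail : ∫ t in (1 : ℝ)..(n * h), φ t ≤ 2 * C * K * h := by
    have h1 : ∫ t in (1 : ℝ)..(n * h), φ t ≤ ∫ _ in (1 : ℝ)..(n * h), 2 * C * K := by
      refine intervalIntegral.integral_mono_on hn1 (hcont.intervalIntegrable _ _)
        intervalIntegrable_const fun t ht => ?_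
      have h2 := (le_abs_self _).trans (hφ t 0)
      rw [hφ0, sub_zero, sub_zero, abs_of_nonneg (by linarith [ht.1])] at h2
      have h3 := mul_le_mul_of_nonneg_left (ht.2.trans hn3) (by positivity : 0 ≤ C * K)
      linarith
    rw [intervalIntegral.integral_const, smul_eq_mul] at h1
    have h2 : (n * h - 1) * (2 * C * K) ≤ h * (2 * C * K) :=
      mul_le_mul_of_nonneg_right (by linarith) (by positivity)
    linarith
  rw [← intervalIntegral.integral_add_adjacent_intervals (hcont.intervalIntegrable 0 1)
    (hcont.intervalIntegrable 1 (n * h))] at hR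
  have hterm : ∀ i ∈ Finset.range n, totalRate lam (trackingPath g T h i) * (T * h) ≤
      T ^ 2 * (h * φ (i * h)) + (a + 4 * C) * (T * h) := by
    intro i _
    have h1 := stateCost_trackingPath_le hlam hT hh.le hKh hg0 hg hK i
    rw [totalRate_eq]
    have h2 := mul_le_mul_of_nonneg_right h1 (by positivity : 0 ≤ T * h)
    have h3 : T * pointCost lam (g (i * h)) * (T * h) = T ^ 2 * (h * φ (i * h)) := by
      simp only [φ]; ring
    linarith
  refine (Finset.sum_le_sum hterm).trans ?_
  rw [Finset.sum_add_distrib, ← Finset.mul_sum, Finset.sum_const, Finset.card_range, nsmul_eq_mul]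
  have e1 : (n : ℝ) * (C * K * h ^ 2) ≤ 2 * C * K * h := by
    have := mul_le_mul_of_nonneg_right hn3 (by positivity : 0 ≤ C * K * h)
    linarith
  have e2 : (n : ℝ) * ((a + 4 * C) * (T * h)) ≤ 2 * ((a + 4 * C) * T) := by
    have := mul_le_mul_of_nonneg_right hn3 (by positivity : 0 ≤ (a + 4 * C) * T)
    linarith
  have e3 := mul_le_mul_of_nonneg_left (hR.trans (add_le_add_right e1 _)) (sq_nonneg T)
  -- The Riemann sum error and the overshoot contribute `2 * C * K * h` each.
  have e4 : T ^ 2 * (4 * (C * K * h)) ≤ 2 * C * T := by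
    have := mul_le_mul_of_nonneg_left hKh (by positivity : 0 ≤ 4 * C * T)
    linarith
  have e5 := mul_le_mul_of_nonneg_left htail (sq_nonneg T)
  linarith

/-- At most `C₃ * T` jumps, each with a factor `c / T` beside the exponential, cost `O(T log T)` in
the exponent; this and the linear error `C₄ * T` fit into `δ / 2 * T ^ 2`. The other half of `δ`
pays for the smoothing. -/
lemma eventually_le_measure_uniformNhd (hlam : ∀ y ∈ jumpSet, 0 < lam y) [IsProbabilityMeasure P]
    {ξ : ℝ → Ω → ℕ × ℕ} (hξ : IsJumpProcess lam P ξ)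
    {f x : unitInterval → EuclideanSpace ℝ (Fin 2)} (hf : f ∈ excursionSet) {ε δ : ℝ}
    (hx : x ∈ uniformNhd f ε) (hδ : 0 < δ) :
    ∀ᶠ T : ℝ in atTop, Real.exp (-(T ^ 2 * (rateFunction lam x + δ))) ≤
      P.real {ω | scaledPath ξ T ω ∈ uniformNhd f ε} := by
  obtain ⟨Y, τ, hc, hstep⟩ := hξ
  obtain ⟨g, K, ε', hK0, hε', hg0, hg, hK, hgf, hcost⟩ :=
    exists_lipschitz_of_mem_uniformNhd hlam hf hx (half_pos hδ)
  obtain ⟨m, hm, hrate⟩ := exists_pos_le_jumpRate_greedyPath hlam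
  have l1 := hlam (1, 0) (by decide)
  have l2 := hlam (0, 1) (by decide)
  have hC := costLip_pos hlam
  set a := lam (1, 0) + lam (0, 1) with ha
  set C := costLip lam with hCdef
  have ha0 : 0 < a := by positivity
  -- The duration of a step before rescaling, independent of `T`: meanwhile `T • g` moves by at most
  -- `K * Δ = 1 / 2`.
  let Δ := 1 / (2 * K)
  have hΔ : 0 < Δ := by positivity
  have hΔK : Δ * K = 1 / 2 := by simp only [Δ]; field_simp
  -- The clock error then uses a quarter of the gap `ε - ε'`; another quarter covers the lattice
  -- error and the current step for large `T`.
  let κ := min 1 ((ε - ε') / (4 * K))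
  have hκ : 0 < κ := lt_min one_pos (div_pos (by linarith) (by positivity))
  have hκ1 : κ ≤ 1 := min_le_left _ _
  have hκ2 : K * κ ≤ (ε - ε') / 4 := by
    have := min_le_right 1 ((ε - ε') / (4 * K))
    calc K * κ ≤ K * ((ε - ε') / (4 * K)) := mul_le_mul_of_nonneg_left this hK0.le
      _ = _ := by field_simp
  let q := 1 - Real.exp (-(a * (Δ * κ)))
  have hq : 0 < q := by
    simp only [q]
    rw [sub_pos, Real.exp_lt_one_iff, neg_lt_zero]
    positivity
  -- `C₂ * T` bounds the total intensity along the path, since `‖g‖ ≤ 2 * K` on `[0, 2]`.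
  let C₂ := a + 4 * C + 2 * (C * K)
  have hC₂ : 0 < C₂ := by positivity
  let c := m / C₂ * q
  have hc0 : 0 < c := by positivity
  let C₃ := 1 / Δ + 1
  have hC₃ : 0 < C₃ := by positivity
  let C₄ := 2 * a + 10 * C
  have hlog := Real.isLittleO_log_id_atTop.bound (div_pos hδ (by positivity : 0 < 4 * C₃))
  filter_upwards [eventually_ge_atTop 1, eventually_ge_atTop Δ,
    eventually_ge_atTop (20 / (ε - ε')), eventually_ge_atTop (4 / δ * (C₃ * |Real.log c| + C₄)),
    hlog] with T hT1 hTΔ hT3 hT4 hT5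
  have hT : 0 < T := by linarith
  have hlogT : 0 ≤ Real.log T := Real.log_nonneg hT1
  let h := Δ / T
  have hh : 0 < h := by positivity
  have hTh : T * h = Δ := by simp only [h]; field_simp
  have hKh : T * (K * h) ≤ 1 / 2 := by
    rw [mul_left_comm, hTh, mul_comm, hΔK]
  -- Enough steps of length `Δ` to reach `T`, with overshoot at most `Δ`.
  let n := ⌊T / Δ⌋₊ + 1
  have hfloor : ((n : ℕ) : ℝ) ≤ T / Δ + 1 := by
    simp only [n]
    push_cast
    linarith [Nat.floor_le (by positivity : 0 ≤ T / Δ)]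
  have hnΔ : T ≤ n * Δ := by
    rw [← div_le_iff₀ hΔ]
    simp only [n]
    push_cast
    exact (Nat.lt_floor_add_one _).le
  have hnΔ2 : n * Δ ≤ T + Δ := by
    have := mul_le_mul_of_nonneg_right hfloor hΔ.le
    rwa [add_mul, one_mul, div_mul_cancel₀ _ hΔ.ne'] at this
  have hnC : (n : ℝ) ≤ C₃ * T := by
    refine hfloor.trans ?_
    simp only [C₃]
    rw [add_mul, one_mul, one_div_mul_eq_div]
    linarith
  have hnh : (n : ℝ) * h = n * Δ / T := by simp only [h]; ring
  have hn1 : 1 ≤ n * h := by rw [hnh, one_le_div hT]; exact hnΔ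
  have hn2 : n * h ≤ 1 + h := by
    rw [hnh, div_le_iff₀ hT, add_mul, one_mul, mul_comm h, hTh]; exact hnΔ2
  have hn3 : n * h ≤ 2 := by
    rw [hnh, div_le_iff₀ hT]; linarith
  have hclose : 4 / T + K * (κ + h * (1 + κ)) + ε' < ε := by
    have e1 : K * (h * (1 + κ)) ≤ 1 / T := by
      have : K * (h * (1 + κ)) = 1 / 2 * (1 + κ) / T := by
        rw [← hΔK]; simp only [h]; ring
      rw [this]
      gcongr
      linarith
    have e2 : 5 / T ≤ (ε - ε') / 4 := by
      rw [div_le_iff₀ (by linarith)] at hT3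
      rw [div_le_iff₀ hT]
      linarith
    have e3 : 5 / T = 4 / T + 1 / T := by ring
    rw [mul_add]
    linarith
  have hprob := hc.le_measureReal_uniformNhd hlam hstep hT hh hK0.le hKh hg0 hg hK hgf hκ.le
    hclose (n := n) (by rw [hTh]; exact hnΔ)
  refine le_trans ?_ hprob
  have hfac : ∀ i ∈ Finset.range n, c / T *
      Real.exp (-(totalRate lam (trackingPath g T h i) * (T * h))) ≤
      jumpProb lam (trackingPath g T h i)
        (increment (trackingPath g T h i) (trackingPath g T h (i + 1))) *
          (Real.exp (-(totalRate lam (trackingPath g T h i) * (T * h))) -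
            Real.exp (-(totalRate lam (trackingPath g T h i) * (T * h * (1 + κ))))) := by
    intro i hi
    have hin : (i : ℝ) * h ≤ 2 := by
      refine le_trans (mul_le_mul_of_nonneg_right ?_ hh.le) hn3
      exact_mod_cast (Finset.mem_range.1 hi).le
    have hH : totalRate lam (trackingPath g T h i) ≤ C₂ * T := by
      have e1 := stateCost_trackingPath_le hlam hT hh.le hKh hg0 hg hK i
      have e2 : pointCost lam (g (i * h)) ≤ 2 * (C * K) := by
        refine (le_abs_self _).trans ((abs_pointCost_le hlam _).trans ?_)
        have e3 := hK (i * h) 0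
        rw [hg0, sub_zero, sub_zero, abs_of_nonneg (by positivity)] at e3
        have e4 := mul_le_mul_of_nonneg_left (e3.trans
          (mul_le_mul_of_nonneg_left hin hK0.le)) hC.le
        linarith
      have e3 := mul_le_mul_of_nonneg_left e2 hT.le
      have e4 := mul_le_mul_of_nonneg_left hT1 (by positivity : 0 ≤ a + 4 * C)
      rw [totalRate_eq, ← ha]
      simp only [C₂]
      linarith
    have := le_jumpProb_mul_exp_sub_exp hlam hm
      (hrate _ _ (fun i => mul_nonneg hT.le (hg (i * h) 0))
        (fun i => mul_nonneg hT.le (hg (i * h) 1)) i) hH (by positivity : 0 ≤ T * h) hκ.le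
    refine le_trans (le_of_eq ?_) this
    simp only [c, q]
    rw [hTh, ← ha]
    congr 1
    field_simp
  refine le_trans ?_ (Finset.prod_le_prod (fun i _ => by positivity) hfac)
  rw [Finset.prod_mul_distrib, Finset.prod_const, Finset.card_range, ← Real.exp_sum,
    ← Real.exp_log (by positivity : 0 < c / T), ← Real.exp_nat_mul, ← Real.exp_add,
    Real.exp_le_exp, Finset.sum_neg_distrib, Real.log_div hc0.ne' hT.ne']
  have hsum := sum_totalRate_trackingPath_le hlam hT hh hK0.le hKh hg0 hg hK hn1 hn2 hn3
  have e1 : -(C₃ * T * (|Real.log c| + Real.log T)) ≤ n * (Real.log c - Real.log T) := by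
    have h1 := mul_le_mul_of_nonneg_right hnC
      (by positivity : 0 ≤ |Real.log c| + Real.log T)
    have h2 : (n : ℝ) * (-(|Real.log c| + Real.log T)) ≤ n * (Real.log c - Real.log T) :=
      mul_le_mul_of_nonneg_left (by linarith [neg_abs_le (Real.log c)]) (Nat.cast_nonneg n)
    linarith
  have e2 : C₃ * |Real.log c| + C₄ ≤ δ / 4 * T := by
    rw [div_mul_eq_mul_div, div_le_iff₀ hδ] at hT4
    linarith
  have e3 : C₃ * Real.log T ≤ δ / 4 * T := by
    rw [Real.norm_eq_abs, abs_of_nonneg hlogT, id, Real.norm_eq_abs, abs_of_pos hT] at hT5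
    have := mul_le_mul_of_nonneg_left hT5 hC₃.le
    have e : C₃ * (δ / (4 * C₃) * T) = δ / 4 * T := by field_simp
    linarith
  have e4 := mul_le_mul_of_nonneg_right (add_le_add e2 e3) hT.le
  have e5 := mul_le_mul_of_nonneg_left hcost (sq_nonneg T)
  linarith

end

end

theorem theorem1 (lam : ℤ × ℤ → ℝ) (hlam : ∀ y ∈ jumpSet, 0 < lam y)
    {Ω : Type*} [MeasurableSpace Ω] (P : Measure Ω) [IsProbabilityMeasure P]
    (ξ : ℝ → Ω → ℕ × ℕ) (hξ : IsJumpProcess lam P ξ)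
    (f : unitInterval → EuclideanSpace ℝ (Fin 2)) (hf : f ∈ excursionSet) :
    ∃ L : ℝ → ℝ,
      (∀ ε : ℝ, 0 < ε →
        (∀ᶠ T : ℝ in atTop, 0 < P.real {ω | scaledPath ξ T ω ∈ uniformNhd f ε}) ∧
        Tendsto (fun T : ℝ =>
            1 / T ^ 2 * Real.log (P.real {ω | scaledPath ξ T ω ∈ uniformNhd f ε}))
          atTop (𝓝 (L ε))) ∧
      Tendsto L (𝓝[>] 0) (𝓝 (-rateFunction lam f)) := by
  refine ⟨fun ε => -infRate lam f ε, fun ε hε => tendsto_log_of_exp_bounds (fun δ hδ => ?_)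
    fun δ hδ => eventually_measure_uniformNhd_le hlam hξ hf ε hδ, (tendsto_infRate hlam hf).neg⟩
  -- The infimum need not be attained: half of `δ` is spent on a near-minimizer, half on its lower
  -- bound.
  obtain ⟨x, hx, hlt⟩ := exists_rateFunction_lt (lam := lam) hf hε (half_pos hδ)
  filter_upwards [eventually_le_measure_uniformNhd hlam hξ hf hx (half_pos hδ)] with T hT
  refine le_trans (Real.exp_le_exp.2 (neg_le_neg (mul_le_mul_of_nonneg_left ?_ (sq_nonneg T)))) hT
  linarith
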